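/- Let $S(x)\in x^2\mathbb{R}[[x]]$ have strictly negative quadratic coefficient, $S(x)=-\frac{x^2}{2a}+V(x)$ with $a>0$ and $V(x)\in x^3\mathbb{R}[[x]]$. For a power series $S(x)=-\frac{x^2}{2a}+V(x)$ with $a\neq 0$ and a chosen value of $\sqrt a$ define the formal integral $$\mathcal F[S](\hbar)=\sqrt a\,\sum_{m\ge 0}(a\hbar)^m(2m-1)!!\,[x^{2m}]\,e^{V(x)/\hbar},$$ a formal power series in $\hbar$; for $a>0$ the positive root is used. Let $x(y)\in\mathbb{R}[[y]]$ be the solution of $\frac{y^2}{2}=-S(x(y))$ with $x(0)=0$ and $x'(0)>0$. Assume that $x(y)$ has a finite positive radius of convergence $r$. Let $\rho_i$, $i\in I$, be its distinct dominant singularities, that is, the points of the circle $|y|=r$ to which $x(y)$ has no analytic continuation from the disc $|y|<r$, and assume that $I$ is finite and that for each $i\in I$: (a) the singularity is of square-root type: as $y\to\rho_i$ in the disc, $x(y)\to\tau_i$ and $x(y)-\tau_i\sim c_i\sqrt{1-y/\rho_i}$ for some $\tau_i\in\mathbb{C}$ and $c_i\in\mathbb{C}\setminus\{0\}$; (b)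 $(\tau_i,\rho_i)$ is a regular point of the curve $\frac{y^2}{2}=-S(x)$, where $S$ is continued analytically along $x(y)$ to an analytic function near $\tau_i$, again denoted $S$. Precisely: $S$ is analytic at $\tau_i$, $\frac{y^2}{2}=-S(x(y))$ for all $y$ in the disc close to $\rho_i$, $\frac{\rho_i^2}{2}=-S(\tau_i)$, and $(S'(\tau_i),\rho_i)\neq(0,0)$. Then for each $i$ the Taylor series of $S(x+\tau_i)-S(\tau_i)$ at $x=0$ has no linear term and a non-zero quadratic term, so that it equals $-\frac{x^2}{2a_i}+\cdots$ with $a_i=-1/S''(\tau_i)$, and with the value of $\sqrt{a_i}$ given by $$\sqrt{a_i}=\lim_{y\to\rho_i}\frac{x(y)-\tau_i}{\mathrm{i}\,\rho_i\sqrt{1-y^2/\rho_i^2}}\qquad(|y|<r,\ \text{principal square root in the denominator}),$$ where the limit exists, the coefficients of $\mathcal F[S](\hbar)$ satisfy, for every integer $R\ge 0$, $$[\hbar^n]\mathcal F[S](\hbar)=\sum_{k=0}^{R-1}\sum_{i\in I}w_{i,k}\,A_i^{-(n-k)}\,\Gamma(n-k)+\mathcal O\Big(\sum_{i\in I}|A_i|^{-n}\,\Gamma(n-R)\Big)\qquad(n\to\infty),$$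 where $A_i=-S(\tau_i)$ and $$w_{i,k}=\frac{1}{2\pi\mathrm{i}}\,[\hbar^k]\,\mathcal F[S(x+\tau_i)-S(\tau_i)](\hbar).$$ -/

import Mathlib

open Filter Topology Asymptotics

noncomputable section

namespace FormalIntegral

/-- `S` is an admissible action: no constant and no linear term, and an invertible quadratic
coefficient, so that `S = - x² / (2 a) + V` with `V` of order at least three. -/
def IsAction {K : Type*} [Field K] (S : PowerSeries K) : Prop :=
  PowerSeries.coeff 0 S = 0 ∧ PowerSeries.coeff 1 S = 0 ∧ PowerSeries.coeff 2 S ≠ 0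

/-- The parameter `a` in `S = - x² / (2 a) + V`. -/
def covariance {K : Type*} [Field K] (S : PowerSeries K) : K :=
  -(2 * PowerSeries.coeff 2 S)⁻¹

/-- The potential `V` in `S = - x² / (2 a) + V`. -/
def potential {K : Type*} [Field K] (S : PowerSeries K) : PowerSeries K :=
  S - PowerSeries.monomial 2 (PowerSeries.coeff 2 S)

/-- The formal integral `√a * ∑ m, (a ħ) ^ m * (2 m - 1)!! * [x ^ (2 m)] exp (V / ħ)`, a power
series in `ħ`, where `s` is the chosen value of `√a`.

Since `exp (V / ħ) = ∑ k, ħ ^ (-k) * V ^ k / k!`, the coefficient of `ħ ^ n` collects the terms with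
`m = n + k`. These vanish for `k > 2 n`, see `coeff_potential_pow_eq_zero` below.
For `m = 0` the truncated subtraction gives `0!! = 1`, which is the usual `(-1)!! = 1`. -/
def formalIntegral {K : Type*} [Field K] (s : K) (S : PowerSeries K) : PowerSeries K :=
  PowerSeries.mk fun n =>
    s * ∑ k ∈ Finset.range (2 * n + 1),
      covariance S ^ (n + k) * (Nat.doubleFactorial (2 * (n + k) - 1) : K) *
        (PowerSeries.coeff (2 * (n + k)) (potential S ^ k) / (Nat.factorial k : K))

/-- The terms left out in `formalIntegral` vanish. -/
theorem coeff_potential_pow_eq_zero {K : Type*} [Field K] {S : PowerSeries K} (hS : IsAction S)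
    {n k : ℕ} (h : 2 * n < k) :
    PowerSeries.coeff (2 * (n + k)) (potential S ^ k) = 0 := by
  have h3 : (PowerSeries.X : PowerSeries K) ^ 3 ∣ potential S := by
    rw [PowerSeries.X_pow_dvd_iff]
    intro m hm
    obtain ⟨h0, h1, h2⟩ := hS
    interval_cases m
    · rw [potential, map_sub, h0, PowerSeries.coeff_monomial]; norm_num
    · rw [potential, map_sub, h1, PowerSeries.coeff_monomial]; norm_num
    · simp [potential]
  have hk : (PowerSeries.X : PowerSeries K) ^ (3 * k) ∣ potential S ^ k := by
    rw [pow_mul]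
    exact pow_dvd_pow_of_dvd h3 k
  exact PowerSeries.X_pow_dvd_iff.1 hk _ (by omega)

/-- `x` is the local solution `x(y)` at the origin, with positive linear coefficient, of
`y² / 2 = - S (x)`, as a formal power series in `y`. -/
def IsLocalSolution (S x : PowerSeries ℝ) : Prop :=
  PowerSeries.coeff 0 x = 0 ∧ 0 < PowerSeries.coeff 1 x ∧
    PowerSeries.C (1 / 2 : ℝ) * PowerSeries.X ^ 2 = -(PowerSeries.subst x S)

/-- The radius of convergence of a real power series, in the complex plane. -/
def convergenceRadius (x : PowerSeries ℝ) : ENNReal :=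
  (FormalMultilinearSeries.ofScalars ℂ fun n => ((PowerSeries.coeff n x : ℝ) : ℂ)).radius

/-- The sum of a real power series at a complex point. -/
def evalAt (x : PowerSeries ℝ) (y : ℂ) : ℂ :=
  ∑' n : ℕ, ((PowerSeries.coeff n x : ℝ) : ℂ) * y ^ n

/-- The dominant singularities of a function `f` on the disc of convergence `|y| < r`: the points
of the boundary circle to which `f` has no analytic continuation. -/
def dominantSingularities (f : ℂ → ℂ) (r : ℝ) : Set ℂ :=
  {ρ | ‖ρ‖ = r ∧ ¬ ∃ g : ℂ → ℂ, AnalyticAt ℂ g ρ ∧ ∀ᶠ y in 𝓝[Metric.ball 0 r] ρ, g y = f y}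

/-- `f` tends to `τ` at `ρ` from inside the disc, and behaves there like a square root:
`f y - τ ∼ c * √(1 - y / ρ)` for some `c ≠ 0`. -/
def IsSquareRootAt (f : ℂ → ℂ) (r : ℝ) (τ ρ : ℂ) : Prop :=
  Tendsto f (𝓝[Metric.ball 0 r] ρ) (𝓝 τ) ∧
    ∃ c : ℂ, c ≠ 0 ∧
      Tendsto (fun y => (f y - τ) / (1 - y / ρ) ^ (1 / 2 : ℂ)) (𝓝[Metric.ball 0 r] ρ) (𝓝 c)

/-- `(τ, ρ)` is a regular point of the analytic curve `y² / 2 = - T (x)`. -/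
def IsRegularPoint (T : ℂ → ℂ) (τ ρ : ℂ) : Prop :=
  AnalyticAt ℂ T τ ∧ ρ ^ 2 / 2 = -T τ ∧ (deriv T τ ≠ 0 ∨ ρ ≠ 0)

/-- `T` is the action near the end point of `x(y)` at `ρ`: it satisfies the equation
`y² / 2 = - T (x(y))` of the curve for all `y` in the disc that are close to `ρ`. For `T` analytic
at the limit of `x(y)` this says that `T` is the analytic continuation of the action along `x(y)`. -/
def ContinuesActionAlong (f : ℂ → ℂ) (r : ℝ) (ρ : ℂ) (T : ℂ → ℂ) : Prop :=
  ∀ᶠ y in 𝓝[Metric.ball 0 r] ρ, y ^ 2 / 2 = -T (f y)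

/-- The Taylor series of `T (x + τ) - T τ` at `x = 0`. -/
def shiftedAction (T : ℂ → ℂ) (τ : ℂ) : PowerSeries ℂ :=
  PowerSeries.mk fun n => if n = 0 then 0 else iteratedDeriv n T τ / (Nat.factorial n : ℂ)

/-- `s` is the value of the square root of the parameter `a` of `T (x + τ) - T τ` that belongs to
the branch `x(y)`: by the equation of the curve, `x(y) - τ ∼ √a * √(y² - ρ²)` as `y → ρ`, and
`√(y² - ρ²)` is taken to be `i ρ √(1 - y² / ρ²)`, with the principal square root. -/
def IsContinuedBranch (f : ℂ → ℂ) (r : ℝ) (τ ρ : ℂ) (T : ℂ → ℂ) (s : ℂ) : Prop :=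
  s ^ 2 = covariance (shiftedAction T τ) ∧
    Tendsto (fun y => (f y - τ) / (Complex.I * ρ * (1 - y ^ 2 / ρ ^ 2) ^ (1 / 2 : ℂ)))
      (𝓝[Metric.ball 0 r] ρ) (𝓝 s)

/-- The coefficients `w k = (2 π i)⁻¹ [ħ ^ k] F[T (x + τ) - T τ]`, where `s` is the value of the
square root of the parameter `a` of `T (x + τ) - T τ`. -/
def saddleCoeff (T : ℂ → ℂ) (τ s : ℂ) (k : ℕ) : ℂ :=
  1 / (2 * (Real.pi : ℂ) * Complex.I) *
    PowerSeries.coeff k (formalIntegral s (shiftedAction T τ))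

end FormalIntegral

end

/-! In the coordinate `y` of the curve `y²/2 = -S(x)` the formal integral is Gaussian: `[ħ^n] F[S] =
(2n+1)!! [y^(2n+1)] x(y)` (`coeff_formalIntegral`). This is a purely algebraic residue computation,
valid over any field of characteristic zero, so it applies at the origin over `ℝ` and at each end
point `τ i` over `ℂ`. Large-order behaviour of `F[S]` thus becomes singularity analysis of `x(y)`.

At a dominant singularity the square-root behaviour forces `T - T τ` to have a double zero at `τ`.
An analytic square root `h` of `-2(T - T τ)` is then locally invertible, and its inverse `X` gives
`x(y) = X(iρ√(1 - y²/ρ²))` (`exists_local_uniformization`). Since `X` solves the curve equation of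
the shifted action, `[ħ^k] F[T(x+τ) - T τ] = (2k+1)!! [z^(2k+1)] X`: the same odd coefficients
govern the singularity and the saddle.

Near `ρ`, `x(y)` is therefore analytic in `w = √(1 - y/ρ)`. Even powers of `w` are polynomials in
`y`; the odd ones are subtracted, and Darboux's method bounds the coefficients of the rest
(`isBigO_coeff_sub_halfBinomial`).

The theorem asks for coefficients in `√(1 - y²/ρ²)` instead of `w`. Its odd powers cannot be
subtracted directly: they are even in `y`, hence contribute nothing to `y^(2n+1)`, and are singular
at `-ρ` as well. Instead the coefficients are written as integrals along the cut `y = ρ/v`, `0 < v <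
1`. There both truncated expansions become explicit functions of `s = √(1/v - 1)` that agree to high
order at `s = 0` and grow polynomially, so their integrals against `v^(2n)` agree up to a power of
`n` (`isBigO_halfBinomial_sub_gamma`). The integrals of odd powers of `√(1/v² - 1)` are Beta values,
and multiplication by `(2n+1)!!` turns them into `A^(-(n-k)) Γ(n-k)` with `A = ρ²/2`. -/

noncomputable section

namespace FormalIntegral

/-! ### Formal residues and the Gaussian coordinate. -/

section FormalChangeOfVariables

open PowerSeries

variable {K : Type*} [Field K] [CharZero K]

/-- The residue of `x ^ (-l - 1) dx` for `x = X ξ`, with `η` the inverse of `ξ`. -/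
theorem coeff_inv_pow_mul_derivative {ξ η : K⟦X⟧} (h : ξ * η = 1) (l : ℕ) :
    coeff l (η ^ (l + 1) * d⁄dX K (X * ξ)) = if l = 0 then 1 else 0 := by
  have hD : d⁄dX K (X * ξ) = ξ + X * d⁄dX K ξ := by
    rw [Derivation.leibniz]; simp [smul_eq_mul]; ring
  have hη : η ^ 2 * d⁄dX K ξ = - d⁄dX K η := by
    have h1 := congrArg (d⁄dX K) h
    rw [Derivation.leibniz, smul_eq_mul, smul_eq_mul, Derivation.map_one_eq_zero] at h1
    linear_combination η * h1 - d⁄dX K η * h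
  rcases Nat.eq_zero_or_pos l with rfl | hl
  · rw [hD]
    have : η ^ (0 + 1) * (ξ + X * d⁄dX K ξ) = 1 + X * (η * d⁄dX K ξ) := by
      linear_combination h
    rw [this]; simp
  · rw [if_neg hl.ne']
    obtain ⟨p, rfl⟩ : ∃ p, l = p + 1 := ⟨l - 1, by omega⟩
    have hl0 : ((p + 1 : ℕ) : K) ≠ 0 := by exact_mod_cast hl.ne'
    have hpow : d⁄dX K (η ^ (p + 1)) = ((p + 1 : ℕ) : K⟦X⟧) * η ^ p * d⁄dX K η := by
      rw [Derivation.leibniz_pow]; simp [nsmul_eq_mul, smul_eq_mul]; ring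
    -- For `l ≠ 0` the form `x^(-l-1) dx` is exact. After clearing poles this is the identity below,
    -- whose right-hand side has vanishing coefficient at `X^(p+1)`.
    have key : ((p + 1 : ℕ) : K⟦X⟧) * (η ^ (p + 1 + 1) * d⁄dX K (X * ξ)) =
        ((p + 1 : ℕ) : K⟦X⟧) * η ^ (p + 1) - X * d⁄dX K (η ^ (p + 1)) := by
      rw [hD, hpow]
      linear_combination ((p + 1 : ℕ) : K⟦X⟧) * η ^ (p + 1) * h +
        ((p + 1 : ℕ) : K⟦X⟧) * η ^ p * X * hη
    have h2 := congrArg (coeff (p + 1)) key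
    have hc : ∀ f : K⟦X⟧, coeff (p + 1) (((p + 1 : ℕ) : K⟦X⟧) * f) =
        ((p + 1 : ℕ) : K) * coeff (p + 1) f := by
      intro f
      rw [← nsmul_eq_mul, map_nsmul, nsmul_eq_mul]
    rw [map_sub, hc, hc, coeff_succ_X_mul, coeff_derivative] at h2
    have h3 : ((p + 1 : ℕ) : K) * coeff (p + 1) (η ^ (p + 1 + 1) * d⁄dX K (X * ξ)) = 0 := by
      rw [h2]; push_cast; ring
    exact (mul_eq_zero.1 h3).resolve_left hl0

/-- Formal change of variables in a residue. -/
theorem coeff_eq_coeff_comp_mul (φ : K⟦X⟧ →ₐ[K] K⟦X⟧) {ξ η : K⟦X⟧}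
    (h : ξ * η = 1) (hφ : φ X = X * ξ) (N : ℕ) (g : K⟦X⟧) :
    coeff N g = coeff N (φ g * η ^ (N + 1) * d⁄dX K (X * ξ)) := by
  have hpow : ∀ j, j ≤ N → ∀ c : K, coeff N (φ (C c * X ^ j) * η ^ (N + 1) * d⁄dX K (X * ξ)) =
      if j = N then c else 0 := by
    intro j hj c
    obtain ⟨l, rfl⟩ := Nat.exists_eq_add_of_le hj
    have h1 : φ (C c * X ^ j) * η ^ (j + l + 1) * d⁄dX K (X * ξ) =
        X ^ j * (C c * (η ^ (l + 1) * d⁄dX K (X * ξ))) := by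
      have hc : φ (C c) = C c := φ.commutes c
      have h2 : ξ ^ j * η ^ j = 1 := by rw [← mul_pow, h, one_pow]
      rw [map_mul, map_pow, hφ, hc, mul_pow]
      linear_combination (C c * X ^ j * η ^ (l + 1) * d⁄dX K (X * ξ)) * h2
    rw [h1, add_comm j l, coeff_X_pow_mul, coeff_C_mul, coeff_inv_pow_mul_derivative h]
    by_cases hl : l = 0 <;> simp [hl]
  -- By linearity only monomials of degree at most `N` matter: the tail is divisible by `X^(N+1)`,
  -- and `φ` preserves this.
  obtain ⟨q, hq⟩ : X ^ (N + 1) ∣ g - ∑ j ∈ Finset.range (N + 1), C (coeff j g) * X ^ j := by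
    rw [X_pow_dvd_iff]
    intro m hm
    rw [map_sub, map_sum]
    simp [coeff_C_mul, coeff_X_pow, hm]
  have hg : g = (∑ j ∈ Finset.range (N + 1), C (coeff j g) * X ^ j) + X ^ (N + 1) * q := by
    rw [← hq]; ring
  have hq0 : coeff N (φ (X ^ (N + 1) * q) * η ^ (N + 1) * d⁄dX K (X * ξ)) = 0 := by
    have : X ^ (N + 1) ∣ φ (X ^ (N + 1) * q) * η ^ (N + 1) * d⁄dX K (X * ξ) := by
      rw [map_mul, map_pow, hφ, mul_pow]
      exact ⟨ξ ^ (N + 1) * φ q * η ^ (N + 1) * d⁄dX K (X * ξ), by ring⟩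
    exact X_pow_dvd_iff.1 this N (by omega)
  conv_rhs => rw [hg]
  rw [map_add, add_mul, add_mul, map_add, hq0, add_zero, map_sum, Finset.sum_mul, Finset.sum_mul,
    map_sum, Finset.sum_congr rfl fun j hj => hpow j (by simpa [Nat.lt_succ_iff] using hj) _]
  simp

/-- A truncation of the binomial series of `(1 - u) ^ (-m / 2)` at `u = 1 - w ^ 2` is
`w ^ (-m)`, up to the order of truncation. -/
theorem X_pow_dvd_binomial_sum {w : K⟦X⟧} (hw : constantCoeff w = 1) (c : ℕ → K) (m : ℕ)
    (hc : ∀ k : ℕ, 2 * ((k : K) + 1) * c (k + 1) = (m + 2 * k) * c k) (N : ℕ) :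
    X ^ (N + 1) ∣ (∑ k ∈ Finset.range (N + 1), C (c k) * (1 - w ^ 2) ^ k) * w ^ m - C (c 0) := by
  set U : K⟦X⟧ := 1 - w ^ 2 with hU
  have hXU : X ∣ U := by
    rw [X_dvd_iff]; simp [hU, hw]
  have hDU : d⁄dX K U = -(2 * w * d⁄dX K w) := by
    rw [hU, map_sub, Derivation.leibniz_pow, Derivation.map_one_eq_zero]
    simp [smul_eq_mul]; ring
  have hDw : ∀ p : ℕ, d⁄dX K (w ^ p) * w = (p : K⟦X⟧) * w ^ p * d⁄dX K w := by
    intro p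
    rw [Derivation.leibniz_pow]
    rcases p with _ | p
    · simp
    · simp [smul_eq_mul, nsmul_eq_mul]; ring
  -- The recursion for `c` makes the derivative telescope to its last term, which has order at least
  -- `N`; in characteristic zero it can be integrated back. The extra factor `w` avoids the exponent
  -- `m - 1`.
  have hderiv : ∀ N, d⁄dX K ((∑ k ∈ Finset.range (N + 1), C (c k) * U ^ k) * w ^ m) * w =
      C (c N) * ((m : K⟦X⟧) + 2 * N) * U ^ N * w ^ m * d⁄dX K w := by
    intro N
    induction N with
    | zero =>
      have h0 : d⁄dX K (C (c 0)) = 0 := derivative_C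
      have := hDw m
      simp only [zero_add, Finset.sum_range_one, pow_zero, mul_one, Derivation.leibniz, h0,
        smul_eq_mul, Nat.cast_zero, mul_zero, add_zero]
      linear_combination C (c 0) * this
    | succ N ih =>
      rw [Finset.sum_range_succ, add_mul, map_add, add_mul, ih]
      have hDC : d⁄dX K (C (c (N + 1))) = 0 := derivative_C
      have hUp : d⁄dX K (U ^ (N + 1)) = ((N : K⟦X⟧) + 1) * U ^ N * -(2 * w * d⁄dX K w) := by
        rw [Derivation.leibniz_pow, hDU]; simp [smul_eq_mul, nsmul_eq_mul]; ring
      have hcC : 2 * ((N : K⟦X⟧) + 1) * C (c (N + 1)) = ((m : K⟦X⟧) + 2 * N) * C (c N) := by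
        have := congrArg (C (R := K)) (hc N)
        have h2 : C (2 : K) = (2 : K⟦X⟧) := map_ofNat C 2
        simpa [h2] using this
      have h2 : U = 1 - w ^ 2 := hU
      rw [Derivation.leibniz, Derivation.leibniz, hDC, hUp]
      simp only [smul_eq_mul]
      have := hDw m
      push_cast
      linear_combination C (c (N + 1)) * U ^ (N + 1) * this - U ^ N * w ^ m * d⁄dX K w * hcC
        + 2 * ((N : K⟦X⟧) + 1) * C (c (N + 1)) * U ^ N * w ^ m * d⁄dX K w * h2
  have hwinv : w * w⁻¹ = 1 := PowerSeries.mul_inv_cancel w (by simp [hw])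
  have hdvd : X ^ N ∣ d⁄dX K ((∑ k ∈ Finset.range (N + 1), C (c k) * U ^ k) * w ^ m) := by
    have h1 : d⁄dX K ((∑ k ∈ Finset.range (N + 1), C (c k) * U ^ k) * w ^ m) =
        U ^ N * (C (c N) * ((m : K⟦X⟧) + 2 * N) * w ^ m * d⁄dX K w * w⁻¹) := by
      have := hderiv N
      linear_combination w⁻¹ * this - d⁄dX K ((∑ k ∈ Finset.range (N + 1), C (c k) * U ^ k) * w ^ m) * hwinv
    rw [h1]
    exact (pow_dvd_pow_of_dvd hXU N).mul_right _
  rw [X_pow_dvd_iff]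
  intro j hj
  rcases j with _ | j
  · have hU0 : constantCoeff U = 0 := X_dvd_iff.1 hXU
    rw [coeff_zero_eq_constantCoeff, map_sub, map_mul, map_sum]
    simp [hw, hU0, Finset.sum_range_succ']
  · have h1 := X_pow_dvd_iff.1 hdvd j (by omega)
    rw [coeff_derivative] at h1
    have h2 : ((j : K) + 1) ≠ 0 := by exact_mod_cast Nat.succ_ne_zero j
    rw [map_sub, (mul_eq_zero.1 h1).resolve_right h2, coeff_C]
    simp

/-- The formal integral in the coordinate `y` given by `y ^ 2 / 2 = - S (x)`. -/
theorem coeff_formalIntegral {S x : K⟦X⟧} (hS : IsAction S) (hx0 : coeff 0 x = 0)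
    (hx1 : coeff 1 x ≠ 0) (heq : C (1 / 2 : K) * X ^ 2 = -(subst x S)) (n : ℕ) :
    coeff n (formalIntegral (coeff 1 x) S) =
      (Nat.doubleFactorial (2 * n + 1) : K) * coeff (2 * n + 1) x ∧
    coeff 1 x ^ 2 = covariance S := by
  obtain ⟨hS0, hS1, hS2⟩ := hS
  obtain ⟨s, hs⟩ : ∃ s, s = coeff 1 x := ⟨_, rfl⟩
  obtain ⟨q, hq⟩ : ∃ q, q = coeff 2 S := ⟨_, rfl⟩
  rw [← hs] at hx1 ⊢
  obtain ⟨ξ, hξ⟩ : X ∣ x := X_dvd_iff.2 (by simpa using hx0)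
  have hξ0 : constantCoeff ξ = s := by
    rw [hs, hξ, ← zero_add 1, coeff_succ_X_mul, coeff_zero_eq_constantCoeff]
  obtain ⟨v, hv⟩ : X ^ 2 ∣ S - C q * X ^ 2 := by
    rw [X_pow_dvd_iff]
    intro m hm
    rw [coeff_zero_eq_constantCoeff] at hS0
    interval_cases m <;> simp [coeff_X_pow, hS0, hS1]
  have hpot : potential S = X ^ 2 * v := by
    rw [potential, ← hv, ← hq, monomial_eq_C_mul_X_pow]
  have hsub : HasSubst x := HasSubst.of_constantCoeff_zero' (by simpa using hx0)
  set φ : K⟦X⟧ →ₐ[K] K⟦X⟧ := substAlgHom hsub with hφ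
  have hφX : φ X = X * ξ := by rw [← hξ, hφ, substAlgHom_X]
  have hφC : ∀ c : K, φ (C c) = C c := fun c => φ.commutes c
  have hφS : φ S = subst x S := by rw [hφ, coe_substAlgHom]
  set η := ξ⁻¹ with hη
  have hξη : ξ * η = 1 := PowerSeries.mul_inv_cancel ξ (by rwa [hξ0])
  have hη0 : constantCoeff η = s⁻¹ := by rw [hη, constantCoeff_inv, hξ0]
  have hmain : ξ ^ 2 * (φ v + C q) = - C (1 / 2 : K) := by
    have hSv : S = X ^ 2 * v + C q * X ^ 2 := by rw [← hv]; ring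
    have h1 : φ S = X ^ 2 * (ξ ^ 2 * (φ v + C q)) := by
      rw [hSv, map_add, map_mul, map_mul, map_pow, hφX, hφC]; ring
    rw [← hφS, h1] at heq
    generalize hE : ξ ^ 2 * (φ v + C q) = E at heq ⊢
    have h2 : X ^ 2 * E = X ^ 2 * (- C (1 / 2 : K)) := by
      linear_combination heq
    exact mul_left_cancel₀ (pow_ne_zero 2 X_ne_zero) h2
  have hv0 : constantCoeff (φ v) = 0 := by
    have hv1 : X ∣ v := by
      have := congrArg (coeff 2) hv
      rw [X_dvd_iff, ← coeff_zero_eq_constantCoeff]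
      rw [show (2 : ℕ) = 0 + 2 from rfl, coeff_X_pow_mul] at this
      rw [← this]; simp [hq]
    obtain ⟨v₁, rfl⟩ := hv1
    rw [map_mul, hφX]; simp
  have hs2q : s ^ 2 * q = -(1 / 2) := by
    have := congrArg constantCoeff hmain
    simpa [hξ0, hv0] using this
  have ha : s ^ 2 = covariance S := by
    rw [covariance, ← hq]
    have h2q : (2 * q) * (2 * q)⁻¹ = 1 := mul_inv_cancel₀ (mul_ne_zero two_ne_zero (hq ▸ hS2))
    linear_combination 2 * (2 * q)⁻¹ * hs2q - s ^ 2 * h2q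
  refine ⟨?_, ha⟩
  set w := C s * η with hw
  have hw0 : constantCoeff w = 1 := by simp [hw, hη0, hx1]
  -- The curve equation divided by `X²`, together with `2s²q = -1`, turns the potential into `1 -
  -- w²` with `w = s/ξ`.
  have hU : φ (C (2 * s ^ 2) * v) = 1 - w ^ 2 := by
    rw [map_mul, hφC, hw]
    have h1 : C (2 * s ^ 2) * C q = (-1 : K⟦X⟧) := by
      rw [← map_mul, show 2 * s ^ 2 * q = -1 by linear_combination 2 * hs2q]; simp
    have h2 : C (2 * s ^ 2) * C (1 / 2 : K) = C s ^ 2 := by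
      rw [← map_mul, ← map_pow]; congr 1; ring
    linear_combination C (2 * s ^ 2) * η ^ 2 * hmain - C (2 * s ^ 2) * (φ v + C q) * (ξ * η + 1) * hξη
      - η ^ 2 * h2 - h1
  -- These are `(2n-1)!!` times the coefficients of `(1 - u)^(-(2n+1)/2)`, so that the sum over `k`
  -- collapses to `(2n-1)!! w^(-(2n+1))` at `u = 1 - w²`.
  set c : ℕ → K := fun k => (Nat.doubleFactorial (2 * (n + k) - 1) : K) / (2 ^ k * Nat.factorial k)
    with hc
  have hcrec : ∀ k : ℕ, 2 * ((k : K) + 1) * c (k + 1) = (((2 * n + 1 : ℕ) : K) + 2 * k) * c k := by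
    intro k
    have h1 : Nat.doubleFactorial (2 * (n + (k + 1)) - 1) =
        (2 * (n + k) + 1) * Nat.doubleFactorial (2 * (n + k) - 1) := by
      rw [show 2 * (n + (k + 1)) - 1 = 2 * (n + k) + 1 by omega, Nat.doubleFactorial_add_one]
    have h2 : (Nat.factorial k : K) ≠ 0 := by exact_mod_cast Nat.factorial_ne_zero k
    have h3 : ((k : K) + 1) ≠ 0 := by exact_mod_cast Nat.succ_ne_zero k
    simp only [hc, h1, Nat.factorial_succ]
    push_cast
    field_simp
    ring
  set g : K⟦X⟧ := ∑ k ∈ Finset.range (2 * n + 1), C (c k) * (C (2 * s ^ 2) * v) ^ k with hg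
  have hF : coeff n (formalIntegral s S) = s * (s ^ 2) ^ n * coeff (2 * n) g := by
    rw [formalIntegral, coeff_mk, mul_assoc, hg, map_sum, Finset.mul_sum, ← ha]
    rw [Finset.mul_sum, Finset.mul_sum]
    refine Finset.sum_congr rfl fun k _ => ?_
    have h2 : (Nat.factorial k : K) ≠ 0 := by exact_mod_cast Nat.factorial_ne_zero k
    rw [hpot, mul_pow, ← pow_mul, show 2 * (n + k) = 2 * n + 2 * k by ring, ← pow_mul,
      coeff_X_pow_mul, mul_pow, ← map_pow, coeff_C_mul, coeff_C_mul]
    simp only [hc]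
    field_simp
    ring_nf
  have hdvd := X_pow_dvd_binomial_sum hw0 c (2 * n + 1) hcrec (2 * n)
  have hφg : φ g = ∑ k ∈ Finset.range (2 * n + 1), C (c k) * (1 - w ^ 2) ^ k := by
    rw [hg, map_sum]
    exact Finset.sum_congr rfl fun k _ => by rw [map_mul, map_pow, hU, hφC]
  rw [← hφg] at hdvd
  obtain ⟨t, ht⟩ := hdvd
  have hgx := coeff_eq_coeff_comp_mul φ hξη hφX (2 * n) g
  -- Up to order `2n` the transformed integrand is a constant, leaving only the Jacobian `x'(y)` in
  -- the residue.
  have hst : φ g * η ^ (2 * n + 1) = C ((s ^ (2 * n + 1))⁻¹ * c 0) +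
      X ^ (2 * n + 1) * (C (s ^ (2 * n + 1))⁻¹ * t) := by
    have h1 : C (s ^ (2 * n + 1))⁻¹ * C s ^ (2 * n + 1) = (1 : K⟦X⟧) := by
      rw [← map_pow, ← map_mul, inv_mul_cancel₀ (pow_ne_zero _ hx1), map_one]
    rw [hw, mul_pow] at ht
    rw [map_mul]
    linear_combination C (s ^ (2 * n + 1))⁻¹ * ht - φ g * η ^ (2 * n + 1) * h1
  rw [hF, hgx, hst, add_mul, map_add, coeff_C_mul, ← hξ, coeff_derivative]
  have h0 : coeff (2 * n) (X ^ (2 * n + 1) * (C (s ^ (2 * n + 1))⁻¹ * t) * d⁄dX K x) = 0 := by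
    rw [mul_assoc]
    exact X_pow_dvd_iff.1 (dvd_mul_right _ _) _ (by omega)
  rw [h0, Nat.doubleFactorial_add_one]
  simp only [hc]
  push_cast
  have hspow : s ^ (2 * n + 1) ≠ 0 := pow_ne_zero _ hx1
  field_simp
  simp
  ring

end FormalChangeOfVariables

/-! ### Darboux's method and continuation beyond the disc. -/

section Darboux

open Metric

theorem eventuallyEq_iteratedDeriv_of_nhdsWithin {U : Set ℂ} (hU : IsOpen U) {f g : ℂ → ℂ} {ζ : ℂ}
    (h : f =ᶠ[𝓝[U] ζ] g) (M : ℕ) : iteratedDeriv M f =ᶠ[𝓝[U] ζ] iteratedDeriv M g := by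
  have h1 := eventually_eventually_nhdsWithin.2 h
  filter_upwards [h1, self_mem_nhdsWithin] with y hy hyU
  rw [hU.nhdsWithin_eq hyU] at hy
  have hy' : f =ᶠ[𝓝 y] g := hy
  exact hy'.iteratedDeriv_eq M

theorem analyticAt_iteratedDeriv {f : ℂ → ℂ} {z : ℂ} (h : AnalyticAt ℂ f z) (M : ℕ) :
    AnalyticAt ℂ (iteratedDeriv M f) z := by
  rw [iteratedDeriv_eq_iterate]
  exact h.iterated_deriv M

/-- Derivatives of a function that is locally analytic up to the boundary of a disc stay bounded. -/
theorem isBigO_iteratedDeriv_of_analyticAt {U : Set ℂ} (hU : IsOpen U) {f g : ℂ → ℂ} {ζ : ℂ}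
    (h : f =ᶠ[𝓝[U] ζ] g) (hg : AnalyticAt ℂ g ζ) (M : ℕ) :
    iteratedDeriv M f =O[𝓝[U] ζ] (fun _ => (1 : ℝ)) := by
  refine (((analyticAt_iteratedDeriv hg M).continuousAt.isBigO_one ℝ).mono
    nhdsWithin_le_nhds).congr' ?_ EventuallyEq.rfl
  exact (eventuallyEq_iteratedDeriv_of_nhdsWithin hU h M).symm

/-- Compactness of the closed disc: interior points are covered by analyticity, boundary points by
hypothesis. -/
theorem exists_norm_iteratedDeriv_le {F : ℂ → ℂ} {r : ℝ} (M : ℕ)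
    (hF : ∀ y ∈ ball (0 : ℂ) r, AnalyticAt ℂ F y)
    (h : ∀ ζ : ℂ, ‖ζ‖ = r → iteratedDeriv M F =O[𝓝[ball 0 r] ζ] (fun _ => (1 : ℝ))) :
    ∃ C, ∀ y ∈ ball (0 : ℂ) r, ‖iteratedDeriv M F y‖ ≤ C := by
  have key : ∃ C, ∀ y ∈ closedBall (0 : ℂ) r ∩ ball (0 : ℂ) r, ‖iteratedDeriv M F y‖ ≤ C := by
    refine (isCompact_closedBall (0 : ℂ) r).induction_on
      (p := fun s => ∃ C, ∀ y ∈ s ∩ ball (0 : ℂ) r, ‖iteratedDeriv M F y‖ ≤ C) ?_ ?_ ?_ ?_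
    · exact ⟨0, by simp⟩
    · rintro s t hst ⟨C, hC⟩
      exact ⟨C, fun y hy => hC y ⟨hst hy.1, hy.2⟩⟩
    · rintro s t ⟨C, hC⟩ ⟨D, hD⟩
      refine ⟨max C D, fun y hy => ?_⟩
      rcases hy.1 with h1 | h1
      · exact (hC y ⟨h1, hy.2⟩).trans (le_max_left _ _)
      · exact (hD y ⟨h1, hy.2⟩).trans (le_max_right _ _)
    · intro ζ hζ
      have hO : iteratedDeriv M F =O[𝓝[ball 0 r] ζ] (fun _ => (1 : ℝ)) := by
        rcases (mem_closedBall_zero_iff.1 hζ).lt_or_eq with h1 | h1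
        · exact isBigO_iteratedDeriv_of_analyticAt isOpen_ball EventuallyEq.rfl
            (hF ζ (mem_ball_zero_iff.2 h1)) M
        · exact h ζ h1
      obtain ⟨C, hC⟩ := hO.bound
      rw [eventually_nhdsWithin_iff] at hC
      refine ⟨_, mem_nhdsWithin_of_mem_nhds hC, C, fun y hy => ?_⟩
      simpa using hy.1 hy.2
  obtain ⟨C, hC⟩ := key
  exact ⟨C, fun y hy => hC y ⟨ball_subset_closedBall hy, hy⟩⟩

/-- Cauchy's estimate for the Taylor coefficients of a function with bounded `M`-th derivative. -/
theorem norm_iteratedDeriv_zero_le {F : ℂ → ℂ} {r : ℝ} (hr : 0 < r) {M n : ℕ} (hMn : M ≤ n)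
    (hF : ∀ y ∈ ball (0 : ℂ) r, AnalyticAt ℂ F y) {C : ℝ}
    (hC : ∀ y ∈ ball (0 : ℂ) r, ‖iteratedDeriv M F y‖ ≤ C) :
    ‖iteratedDeriv n F 0‖ * r ^ (n - M) ≤ (n - M).factorial * C := by
  obtain ⟨p, rfl⟩ := Nat.exists_eq_add_of_le hMn
  rw [Nat.add_sub_cancel_left]
  have h1 : iteratedDeriv (M + p) F = iteratedDeriv p (iteratedDeriv M F) := by
    rw [iteratedDeriv_eq_iterate, iteratedDeriv_eq_iterate, iteratedDeriv_eq_iterate, add_comm,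
      Function.iterate_add_apply]
  have h2 : ∀ R ∈ Set.Ioo 0 r, ‖iteratedDeriv (M + p) F 0‖ * R ^ p ≤ p.factorial * C := by
    intro R hR
    have hsub : closedBall (0 : ℂ) R ⊆ ball 0 r := closedBall_subset_ball hR.2
    have h3 := Complex.norm_iteratedDeriv_le_of_forall_mem_sphere_norm_le (c := 0) (R := R) (C := C)
      (f := iteratedDeriv M F) p hR.1 ?_ ?_
    · rw [h1]
      rwa [le_div_iff₀ (pow_pos hR.1 p)] at h3
    · refine DifferentiableOn.diffContOnCl fun y hy => ?_
      rw [closure_ball _ hR.1.ne'] at hy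
      exact (analyticAt_iteratedDeriv (hF y (hsub hy)) M).differentiableAt.differentiableWithinAt
    · intro y hy
      exact hC y (hsub (sphere_subset_closedBall hy))
  -- Cauchy's estimate needs a circle inside the open disc; the bound is uniform, so the radius may
  -- tend to `r`.
  have h4 : Tendsto (fun R : ℝ => ‖iteratedDeriv (M + p) F 0‖ * R ^ p) (𝓝[<] r)
      (𝓝 (‖iteratedDeriv (M + p) F 0‖ * r ^ p)) :=
    ((by fun_prop : Continuous fun R : ℝ => ‖iteratedDeriv (M + p) F 0‖ * R ^ p).tendsto r).mono_left
      nhdsWithin_le_nhds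
  exact le_of_tendsto h4 (Filter.eventually_of_mem (Ioo_mem_nhdsLT hr) h2)

/-- Darboux's method: if the `M`-th derivative is bounded up to the circle `|y| = r`, then the
coefficients are `O(r ^ (-n) n ^ (-M))`. -/
theorem isBigO_coeff_of_iteratedDeriv {F : ℂ → ℂ} {r : ℝ} (hr : 0 < r) (M : ℕ)
    (hF : ∀ y ∈ ball (0 : ℂ) r, AnalyticAt ℂ F y)
    (h : ∀ ζ : ℂ, ‖ζ‖ = r → iteratedDeriv M F =O[𝓝[ball 0 r] ζ] (fun _ => (1 : ℝ))) :
    (fun n : ℕ => iteratedDeriv n F 0 / (n.factorial : ℂ) * (r : ℂ) ^ n)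
      =O[atTop] fun n : ℕ => ((n : ℝ) ^ M)⁻¹ := by
  obtain ⟨C, hC⟩ := exists_norm_iteratedDeriv_le M hF h
  refine IsBigO.of_bound (C * r ^ M * 2 ^ M) ?_
  filter_upwards [eventually_ge_atTop (2 * M + 1)] with n hn
  have h1 := norm_iteratedDeriv_zero_le hr (show M ≤ n by omega) hF hC
  have hn0 : (0 : ℝ) < n := by exact_mod_cast (show 0 < n by omega)
  -- For `n ≥ 2M + 1` each factor of `n(n-1)⋯(n-M+1) = n!/(n-M)!` is at least `n/2`.
  have hpow : (n : ℝ) ^ M ≤ 2 ^ M * (n.descFactorial M : ℝ) := by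
    have h2 := Nat.pow_sub_le_descFactorial n M
    have h3 : n ≤ 2 * (n + 1 - M) := by omega
    have h4 : n ^ M ≤ 2 ^ M * n.descFactorial M :=
      (Nat.pow_le_pow_left h3 M).trans (by rw [mul_pow]; exact Nat.mul_le_mul_left _ h2)
    exact_mod_cast h4
  have hfac : ((n - M).factorial : ℝ) * n.descFactorial M = n.factorial := by
    exact_mod_cast Nat.factorial_mul_descFactorial (show M ≤ n by omega)
  have hC0 : 0 ≤ C := (norm_nonneg _).trans (hC 0 (by simpa using hr))
  have hfpos : (0 : ℝ) < n.factorial := by exact_mod_cast Nat.factorial_pos n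
  have hrn : r ^ n = r ^ (n - M) * r ^ M := by rw [← pow_add]; congr 1; omega
  rw [norm_mul, norm_div, norm_pow, Complex.norm_real, Complex.norm_natCast, norm_inv, norm_pow,
    Real.norm_natCast, Real.norm_of_nonneg hr.le, ← div_eq_mul_inv, le_div_iff₀ (by positivity),
    div_mul_eq_mul_div, div_mul_eq_mul_div, div_le_iff₀ hfpos, hrn]
  calc ‖iteratedDeriv n F 0‖ * (r ^ (n - M) * r ^ M) * n ^ M
      = (‖iteratedDeriv n F 0‖ * r ^ (n - M)) * r ^ M * n ^ M := by ring
    _ ≤ ((n - M).factorial * C) * r ^ M * (2 ^ M * n.descFactorial M) := by gcongr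
    _ = C * r ^ M * 2 ^ M * n.factorial := by rw [← hfac]; ring

/-- A function on a disc that continues analytically to all boundary points has derivatives which
are uniformly bounded. -/
theorem exists_norm_iteratedDeriv_le_geometric {F : ℂ → ℂ} {r : ℝ}
    (hF : ∀ y ∈ ball (0 : ℂ) r, AnalyticAt ℂ F y)
    (h : ∀ ζ : ℂ, ‖ζ‖ = r → ∃ g : ℂ → ℂ, AnalyticAt ℂ g ζ ∧ ∀ᶠ y in 𝓝[ball 0 r] ζ, g y = F y) :
    ∃ C D : ℝ, 0 ≤ C ∧ 0 < D ∧ ∀ y ∈ ball (0 : ℂ) r, ∀ M : ℕ,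
      ‖iteratedDeriv M F y‖ ≤ C * M.factorial * D ^ M := by
  have key : ∃ C D : ℝ, 0 ≤ C ∧ 0 < D ∧ ∀ y ∈ closedBall (0 : ℂ) r ∩ ball (0 : ℂ) r, ∀ M : ℕ,
      ‖iteratedDeriv M F y‖ ≤ C * M.factorial * D ^ M := by
    refine (isCompact_closedBall (0 : ℂ) r).induction_on
      (p := fun s => ∃ C D : ℝ, 0 ≤ C ∧ 0 < D ∧ ∀ y ∈ s ∩ ball (0 : ℂ) r, ∀ M : ℕ,
        ‖iteratedDeriv M F y‖ ≤ C * M.factorial * D ^ M) ?_ ?_ ?_ ?_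
    · exact ⟨0, 1, le_rfl, one_pos, by simp⟩
    · rintro s t hst ⟨C, D, hC, hD, hs⟩
      exact ⟨C, D, hC, hD, fun y hy => hs y ⟨hst hy.1, hy.2⟩⟩
    · rintro s t ⟨C, D, hC, hD, hs⟩ ⟨C', D', hC', hD', ht⟩
      refine ⟨C + C', D + D', by positivity, by positivity, fun y hy M => ?_⟩
      rcases hy.1 with h1 | h1
      · refine (hs y ⟨h1, hy.2⟩ M).trans ?_
        gcongr <;> linarith
      · refine (ht y ⟨h1, hy.2⟩ M).trans ?_
        gcongr <;> linarith
    · intro ζ hζ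
      obtain ⟨g, hg, hgF⟩ : ∃ g : ℂ → ℂ, AnalyticAt ℂ g ζ ∧ ∀ᶠ y in 𝓝[ball 0 r] ζ, g y = F y := by
        rcases (mem_closedBall_zero_iff.1 hζ).lt_or_eq with h1 | h1
        · exact ⟨F, hF ζ (mem_ball_zero_iff.2 h1), Eventually.of_forall fun _ => rfl⟩
        · exact h ζ h1
      have hbd : ∀ᶠ y in 𝓝 ζ, ‖g y‖ ≤ ‖g ζ‖ + 1 :=
        hg.continuousAt.norm.eventually_le_const (by linarith)
      obtain ⟨ε, hε, hball⟩ := Metric.eventually_nhds_iff_ball.1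
        ((hg.eventually_analyticAt.and hbd).and (eventually_nhdsWithin_iff.1 hgF))
      -- Halving the radius leaves room for a Cauchy circle of radius `ε/2` around every point, so
      -- one geometric rate serves all orders `M`.
      refine ⟨ball ζ (ε / 2), mem_nhdsWithin_of_mem_nhds (ball_mem_nhds _ (by positivity)),
        ‖g ζ‖ + 1, (ε / 2)⁻¹, by positivity, by positivity, fun y hy M => ?_⟩
      have hyε : y ∈ ball ζ ε := ball_subset_ball (by linarith) hy.1
      have heq : F =ᶠ[𝓝 y] g := by
        filter_upwards [isOpen_ball.mem_nhds hyε, isOpen_ball.mem_nhds hy.2] with z hz hz'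
        exact ((hball z hz).2 hz').symm
      rw [heq.iteratedDeriv_eq M]
      have hsub : closedBall y (ε / 2) ⊆ ball ζ ε := by
        refine closedBall_subset_ball' ?_
        have := mem_ball.1 hy.1
        linarith
      have := Complex.norm_iteratedDeriv_le_of_forall_mem_sphere_norm_le (c := y) (R := ε / 2)
        (C := ‖g ζ‖ + 1) (f := g) M (by positivity) ?_ ?_
      · refine this.trans (le_of_eq ?_)
        rw [inv_pow, div_eq_mul_inv]; ring
      · refine DifferentiableOn.diffContOnCl fun z hz => ?_
        rw [closure_ball _ (by positivity)] at hz
        exact (hball z (hsub hz)).1.1.differentiableAt.differentiableWithinAt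
      · intro z hz
        exact (hball z (hsub (sphere_subset_closedBall hz))).1.2
  obtain ⟨C, D, hC, hD, hs⟩ := key
  exact ⟨C, D, hC, hD, fun y hy => hs y ⟨ball_subset_closedBall hy, hy⟩⟩

/-- If a function continues analytically to all boundary points of a disc, then its Taylor series
converges in a larger disc. -/
theorem exists_lt_norm_coeff_mul_pow_le {F : ℂ → ℂ} {r : ℝ} (hr : 0 < r)
    (hF : ∀ y ∈ ball (0 : ℂ) r, AnalyticAt ℂ F y)
    (h : ∀ ζ : ℂ, ‖ζ‖ = r → ∃ g : ℂ → ℂ, AnalyticAt ℂ g ζ ∧ ∀ᶠ y in 𝓝[ball 0 r] ζ, g y = F y) :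
    ∃ R C : ℝ, r < R ∧ ∀ n : ℕ, ‖iteratedDeriv n F 0 / (n.factorial : ℂ)‖ * R ^ n ≤ C := by
  obtain ⟨C, D, hC, hD, hb⟩ := exists_norm_iteratedDeriv_le_geometric hF h
  -- Expanding `R^n` binomially, Cauchy's estimate applied to the `M`-th derivative bounds the
  -- `M`-th term by `C / 2^M`; the sum is at most `2C`.
  refine ⟨r + (2 * D)⁻¹, 2 * C, by simpa using hD, fun n => ?_⟩
  have hfpos : (0 : ℝ) < n.factorial := by exact_mod_cast Nat.factorial_pos n
  set a := ‖iteratedDeriv n F 0 / (n.factorial : ℂ)‖ with ha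
  have ha' : ‖iteratedDeriv n F 0‖ = a * n.factorial := by
    rw [ha, norm_div, Complex.norm_natCast, div_mul_cancel₀ _ hfpos.ne']
  have hterm : ∀ M ∈ Finset.range (n + 1),
      a * ((2 * D)⁻¹ ^ M * r ^ (n - M) * (n.choose M : ℝ)) ≤ C * (1 / 2) ^ M := by
    intro M hM
    have hMn : M ≤ n := by simpa [Nat.lt_succ_iff] using hM
    have h1 := norm_iteratedDeriv_zero_le hr hMn hF fun y hy => hb y hy M
    rw [ha'] at h1
    have hch : (n.choose M : ℝ) * M.factorial * (n - M).factorial = n.factorial := by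
      exact_mod_cast Nat.choose_mul_factorial_mul_factorial hMn
    have hp1 : (0 : ℝ) < M.factorial := by exact_mod_cast Nat.factorial_pos M
    have hp2 : (0 : ℝ) < (n - M).factorial := by exact_mod_cast Nat.factorial_pos (n - M)
    rw [← hch] at h1
    have h2 : a * r ^ (n - M) * n.choose M ≤ C * D ^ M := by
      have : (a * r ^ (n - M) * n.choose M) * (M.factorial * (n - M).factorial) ≤
          (C * D ^ M) * (M.factorial * (n - M).factorial) := by linarith
      exact le_of_mul_le_mul_right this (by positivity)
    calc a * ((2 * D)⁻¹ ^ M * r ^ (n - M) * (n.choose M : ℝ))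
        = (2 * D)⁻¹ ^ M * (a * r ^ (n - M) * n.choose M) := by ring
      _ ≤ (2 * D)⁻¹ ^ M * (C * D ^ M) := by gcongr
      _ = C * ((2 * D)⁻¹ * D) ^ M := by rw [mul_pow]; ring
      _ = C * (1 / 2) ^ M := by congr 2; field_simp
  rw [add_comm r, add_pow, Finset.mul_sum]
  refine (Finset.sum_le_sum hterm).trans ?_
  rw [← Finset.mul_sum, mul_comm 2 C]
  gcongr
  exact sum_geometric_two_le (n + 1)

end Darboux

/-! ### Taylor series of analytic functions as formal power series. -/

section TaylorSeries

/-- The Taylor series of `f` at `c`. -/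
def taylorSeries (f : ℂ → ℂ) (c : ℂ) : PowerSeries ℂ :=
  PowerSeries.mk fun n => iteratedDeriv n f c / (n.factorial : ℂ)

theorem coeff_taylorSeries (f : ℂ → ℂ) (c : ℂ) (n : ℕ) :
    PowerSeries.coeff n (taylorSeries f c) = iteratedDeriv n f c / (n.factorial : ℂ) :=
  PowerSeries.coeff_mk _ _

theorem taylorSeries_congr {f g : ℂ → ℂ} {c : ℂ} (h : f =ᶠ[𝓝 c] g) :
    taylorSeries f c = taylorSeries g c := by
  ext n
  rw [coeff_taylorSeries, coeff_taylorSeries, h.iteratedDeriv_eq n]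

theorem coeff_taylorSeries_of_hasFPowerSeriesAt {f : ℂ → ℂ} {c : ℂ}
    {p : FormalMultilinearSeries ℂ ℂ ℂ} (hp : HasFPowerSeriesAt f p c) (n : ℕ) :
    PowerSeries.coeff n (taylorSeries f c) = p.coeff n := by
  have h := hp.analyticAt.hasFPowerSeriesAt
  rw [hp.eq_formalMultilinearSeries h, FormalMultilinearSeries.coeff_ofScalars, coeff_taylorSeries]

/-- Taylor's formula with an analytic remainder. -/
theorem exists_taylor_remainder {f : ℂ → ℂ} {c : ℂ} (hf : AnalyticAt ℂ f c) (N : ℕ) :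
    ∃ Y : ℂ → ℂ, AnalyticAt ℂ Y c ∧
      Y c = PowerSeries.coeff N (taylorSeries f c) ∧
      ∀ z, f z = ∑ j ∈ Finset.range N, PowerSeries.coeff j (taylorSeries f c) * (z - c) ^ j +
        (z - c) ^ N * Y z := by
  induction N generalizing f with
  | zero =>
    exact ⟨f, hf, by simp [coeff_taylorSeries], by simp⟩
  | succ N ih =>
    have hp := hf.hasFPowerSeriesAt
    -- The slope `(f(z) - f(c))/(z - c)` is analytic and its Taylor coefficients are those of `f`
    -- shifted by one.
    have hd := hp.has_fpower_series_dslope_fslope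
    obtain ⟨Y, hY, hYc, h⟩ := ih hd.analyticAt
    have hco : ∀ j, PowerSeries.coeff j (taylorSeries (dslope f c) c) =
        PowerSeries.coeff (j + 1) (taylorSeries f c) := by
      intro j
      rw [coeff_taylorSeries_of_hasFPowerSeriesAt hd, FormalMultilinearSeries.coeff_fslope,
        coeff_taylorSeries_of_hasFPowerSeriesAt hp]
    refine ⟨Y, hY, by rw [hYc, hco], fun z => ?_⟩
    have h1 : (z - c) * dslope f c z = f z - f c := by
      simpa using sub_smul_dslope f c z
    rw [h z] at h1
    have h2 : PowerSeries.coeff 0 (taylorSeries f c) = f c := by simp [coeff_taylorSeries]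
    rw [Finset.sum_range_succ', h2]
    simp only [hco] at h1
    rw [mul_add, Finset.mul_sum] at h1
    have h3 : ∑ j ∈ Finset.range N, (z - c) * (PowerSeries.coeff (j + 1) (taylorSeries f c) *
        (z - c) ^ j) = ∑ j ∈ Finset.range N, PowerSeries.coeff (j + 1) (taylorSeries f c) *
        (z - c) ^ (j + 1) := Finset.sum_congr rfl fun j _ => by ring
    rw [h3] at h1
    linear_combination -h1

theorem taylorSeries_isBigO {f : ℂ → ℂ} (hf : AnalyticAt ℂ f 0) (N : ℕ) :
    (fun z => f z - ∑ j ∈ Finset.range N, PowerSeries.coeff j (taylorSeries f 0) * z ^ j)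
      =O[𝓝 0] fun z => z ^ N := by
  obtain ⟨Y, hY, -, h⟩ := exists_taylor_remainder hf N
  have h1 : (fun z => f z - ∑ j ∈ Finset.range N, PowerSeries.coeff j (taylorSeries f 0) * z ^ j) =
      fun z => z ^ N * Y z := by
    funext z
    have := h z
    simp only [sub_zero] at this
    rw [this]; ring
  rw [h1]
  simpa using (isBigO_refl (fun z : ℂ => z ^ N) (𝓝 0)).mul
    (hY.continuousAt.isBigO_one ℂ)

theorem taylorSeries_add {f g : ℂ → ℂ} {c : ℂ} (hf : AnalyticAt ℂ f c) (hg : AnalyticAt ℂ g c) :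
    taylorSeries (fun z => f z + g z) c = taylorSeries f c + taylorSeries g c := by
  ext n
  rw [map_add, coeff_taylorSeries, coeff_taylorSeries, coeff_taylorSeries,
    iteratedDeriv_fun_add hf.contDiffAt hg.contDiffAt, add_div]

theorem taylorSeries_mul {f g : ℂ → ℂ} {c : ℂ} (hf : AnalyticAt ℂ f c) (hg : AnalyticAt ℂ g c) :
    taylorSeries (fun z => f z * g z) c = taylorSeries f c * taylorSeries g c := by
  ext n
  rw [PowerSeries.coeff_mul, Finset.Nat.sum_antidiagonal_eq_sum_range_succ_mk, coeff_taylorSeries,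
    iteratedDeriv_fun_mul hf.contDiffAt hg.contDiffAt, Finset.sum_div]
  refine Finset.sum_congr rfl fun i hi => ?_
  have hin : i ≤ n := by simpa [Nat.lt_succ_iff] using hi
  rw [coeff_taylorSeries, coeff_taylorSeries, Nat.cast_choose ℂ hin]
  have h1 : (n.factorial : ℂ) ≠ 0 := by exact_mod_cast n.factorial_ne_zero
  have h2 : (i.factorial : ℂ) ≠ 0 := by exact_mod_cast i.factorial_ne_zero
  have h3 : ((n - i).factorial : ℂ) ≠ 0 := by exact_mod_cast (n - i).factorial_ne_zero
  field_simp

theorem taylorSeries_const (a c : ℂ) : taylorSeries (fun _ => a) c = PowerSeries.C a := by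
  ext n
  rw [coeff_taylorSeries, PowerSeries.coeff_C, iteratedDeriv_const]
  split_ifs with h <;> simp [h]

theorem taylorSeries_pow {f : ℂ → ℂ} {c : ℂ} (hf : AnalyticAt ℂ f c) (k : ℕ) :
    taylorSeries (fun z => f z ^ k) c = taylorSeries f c ^ k := by
  induction k with
  | zero => simpa using taylorSeries_const 1 c
  | succ k ih =>
    simp only [pow_succ]
    rw [taylorSeries_mul (hf.fun_pow k) hf, ih]

theorem taylorSeries_id : taylorSeries (fun z => z) 0 = PowerSeries.X := by
  ext n
  rw [coeff_taylorSeries, PowerSeries.coeff_X, iteratedDeriv_fun_id]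
  rcases n with _ | _ | n <;> simp

theorem taylorSeries_sum {f : ℕ → ℂ → ℂ} {c : ℂ} (hf : ∀ j, AnalyticAt ℂ (f j) c) (N : ℕ) :
    taylorSeries (fun z => ∑ j ∈ Finset.range N, f j z) c =
      ∑ j ∈ Finset.range N, taylorSeries (f j) c := by
  induction N with
  | zero => simpa using taylorSeries_const 0 c
  | succ N ih =>
    simp only [Finset.sum_range_succ]
    rw [taylorSeries_add (Finset.analyticAt_fun_sum _ fun j _ => hf j) (hf N), ih]

/-- The Taylor series of a composition is the substitution of the Taylor series. -/
theorem taylorSeries_comp {G x : ℂ → ℂ} (hG : AnalyticAt ℂ G 0) (hx : AnalyticAt ℂ x 0)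
    (hx0 : x 0 = 0) :
    taylorSeries (fun z => G (x z)) 0 =
      PowerSeries.subst (taylorSeries x 0) (taylorSeries G 0) := by
  have hxc : PowerSeries.constantCoeff (taylorSeries x 0) = 0 := by
    rw [← PowerSeries.coeff_zero_eq_constantCoeff_apply, coeff_taylorSeries]; simp [hx0]
  have hsub : PowerSeries.HasSubst (taylorSeries x 0) :=
    PowerSeries.HasSubst.of_constantCoeff_zero' hxc
  obtain ⟨φ, hφ⟩ : ∃ φ, φ = PowerSeries.substAlgHom (R := ℂ) hsub := ⟨_, rfl⟩
  have hφs : PowerSeries.subst (taylorSeries x 0) (taylorSeries G 0) = φ (taylorSeries G 0) := by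
    rw [hφ, PowerSeries.coe_substAlgHom]
  have hφX : φ PowerSeries.X = taylorSeries x 0 := by rw [hφ, PowerSeries.substAlgHom_X]
  have hφC : ∀ a : ℂ, φ (PowerSeries.C a) = PowerSeries.C a := fun a => φ.commutes a
  rw [hφs]
  ext N
  have hXdvd : PowerSeries.X ∣ taylorSeries x 0 := PowerSeries.X_dvd_iff.2 hxc
  obtain ⟨Y, hY, -, h⟩ := exists_taylor_remainder hG (N + 1)
  simp only [sub_zero] at h
  have hpow : ∀ (p : ℕ) {g : ℂ → ℂ}, AnalyticAt ℂ g 0 →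
      AnalyticAt ℂ (fun z => g z ^ p) 0 := fun p g hg => hg.fun_pow p
  have hY' : AnalyticAt ℂ (fun z => Y (x z)) 0 := by
    refine AnalyticAt.fun_comp ?_ hx
    rwa [hx0]
  have hterm : ∀ (j : ℕ) {g : ℂ → ℂ}, AnalyticAt ℂ g 0 →
      AnalyticAt ℂ (fun z => PowerSeries.coeff j (taylorSeries G 0) * g z ^ j) 0 := by
    intro j g hg
    exact analyticAt_const.fun_mul (hg.fun_pow j)
  -- Used twice: `g = x` expands the composition, and `g = id` expands `G` itself, to which `φ` is
  -- then applied. The remainders have order above `N` in both cases.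
  have htaylor : ∀ (g : ℂ → ℂ), AnalyticAt ℂ g 0 → AnalyticAt ℂ (fun z => Y (g z)) 0 →
      taylorSeries (fun z => G (g z)) 0 = ∑ j ∈ Finset.range (N + 1),
        PowerSeries.C (PowerSeries.coeff j (taylorSeries G 0)) * taylorSeries g 0 ^ j +
        taylorSeries g 0 ^ (N + 1) * taylorSeries (fun z => Y (g z)) 0 := by
    intro g hg hYg
    have h1 : (fun z => G (g z)) = fun z => (∑ j ∈ Finset.range (N + 1),
        PowerSeries.coeff j (taylorSeries G 0) * g z ^ j) + g z ^ (N + 1) * Y (g z) :=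
      funext fun z => h (g z)
    rw [h1, taylorSeries_add (Finset.analyticAt_fun_sum _ fun j _ => hterm j hg)
      ((hg.fun_pow _).fun_mul hYg), taylorSeries_sum (fun j => hterm j hg),
      taylorSeries_mul (hg.fun_pow _) hYg, taylorSeries_pow hg]
    congr 1
    refine Finset.sum_congr rfl fun j _ => ?_
    rw [taylorSeries_mul analyticAt_const (hg.fun_pow j), taylorSeries_const, taylorSeries_pow hg]
  have h1 := htaylor x hx hY'
  have h2 := htaylor (fun z => z) analyticAt_id hY
  have h3 : taylorSeries G 0 = ∑ j ∈ Finset.range (N + 1),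
        PowerSeries.C (PowerSeries.coeff j (taylorSeries G 0)) * PowerSeries.X ^ j +
        PowerSeries.X ^ (N + 1) * taylorSeries Y 0 := by
    rw [taylorSeries_id] at h2; exact h2
  have hvan : ∀ q : PowerSeries ℂ,
      PowerSeries.coeff N (taylorSeries x 0 ^ (N + 1) * q) = 0 := by
    intro q
    exact PowerSeries.X_pow_dvd_iff.1 ((pow_dvd_pow_of_dvd hXdvd (N + 1)).mul_right q) N (by omega)
  rw [h1, map_add, hvan]
  conv_rhs => rw [h3]
  rw [map_add, map_mul, map_pow, hφX, map_add, hvan, map_sum φ]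
  simp only [map_mul, map_pow, hφX, hφC]

end TaylorSeries

/-! ### Principal square roots on the unit disc. -/

section SquareRoots

/-- The principal square root of `1 - u ^ 2` factors on the unit disc. -/
theorem one_sub_sq_cpow {u : ℂ} (hu : ‖u‖ < 1) :
    (1 - u ^ 2) ^ (1 / 2 : ℂ) = (1 - u) ^ (1 / 2 : ℂ) * (1 + u) ^ (1 / 2 : ℂ) := by
  have hre := (abs_le.1 (Complex.abs_re_le_norm u))
  have h1 : 0 < (1 - u).re := by simp; linarith
  have h2 : 0 < (1 + u).re := by simp; linarith
  have h1' : (1 - u) ≠ 0 := fun h => by rw [h] at h1; simp at h1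
  have h2' : (1 + u) ≠ 0 := fun h => by rw [h] at h2; simp at h2
  -- Both factors lie in the right half-plane, so their arguments add without leaving `(-π, π)`.
  have a1 := abs_lt.1 (Complex.abs_arg_lt_pi_div_two_iff.2 (Or.inl h1))
  have a2 := abs_lt.1 (Complex.abs_arg_lt_pi_div_two_iff.2 (Or.inl h2))
  have hlog := Complex.log_mul h1' h2' ⟨by linarith [a1.1, a2.1], by linarith [a1.2, a2.2]⟩
  rw [show 1 - u ^ 2 = (1 - u) * (1 + u) by ring, Complex.cpow_def_of_ne_zero (mul_ne_zero h1' h2'),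
    Complex.cpow_def_of_ne_zero h1', Complex.cpow_def_of_ne_zero h2', hlog, add_mul, Complex.exp_add]

theorem cpow_half_sq (u : ℂ) : (u ^ (1 / 2 : ℂ)) ^ 2 = u := by
  simp

end SquareRoots

/-! ### Local uniformization at a dominant singularity. -/

section LocalInversion

open Metric

theorem norm_div_lt_one_of_mem_ball {r : ℝ} {ρ y : ℂ} (hr : 0 < r) (hρ : ‖ρ‖ = r)
    (hy : y ∈ ball (0 : ℂ) r) : ‖y / ρ‖ < 1 := by
  rw [norm_div, hρ, div_lt_one hr]
  exact mem_ball_zero_iff.1 hy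

theorem neBot_nhdsWithin_ball {r : ℝ} {ρ : ℂ} (hr : 0 < r) (hρ : ‖ρ‖ = r) :
    (𝓝[ball (0 : ℂ) r] ρ).NeBot := by
  rw [← mem_closure_iff_nhdsWithin_neBot, closure_ball _ hr.ne']
  simp [hρ]

theorem one_sub_ne_zero_of_norm_lt {u : ℂ} (hu : ‖u‖ < 1) : 1 - u ≠ 0 := by
  intro h
  rw [← sub_eq_zero.1 h] at hu
  simp at hu

/-- The curve `y ^ 2 / 2 = - T (x)` has an end point of order two: `T` is critical at `τ`, with a
second derivative determined by the square-root behaviour of `x (y)`. -/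
theorem exists_quadratic_factor {f : ℂ → ℂ} {r : ℝ} (hr : 0 < r) {τ ρ c : ℂ} (hρ : ‖ρ‖ = r)
    {T : ℂ → ℂ} (hf : Tendsto f (𝓝[ball 0 r] ρ) (𝓝 τ)) (hc : c ≠ 0)
    (hfc : Tendsto (fun y => (f y - τ) / (1 - y / ρ) ^ (1 / 2 : ℂ)) (𝓝[ball 0 r] ρ) (𝓝 c))
    (hT : AnalyticAt ℂ T τ) (hTτ : ρ ^ 2 / 2 = -T τ)
    (hcont : ∀ᶠ y in 𝓝[ball 0 r] ρ, y ^ 2 / 2 = -T (f y)) :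
    ∃ q : ℂ → ℂ, AnalyticAt ℂ q τ ∧ (∀ x, T x - T τ = (x - τ) ^ 2 * q x) ∧
      q τ = ρ ^ 2 / c ^ 2 ∧ PowerSeries.coeff 1 (shiftedAction T τ) = 0 ∧
      PowerSeries.coeff 2 (shiftedAction T τ) = q τ := by
  have hρ0 : ρ ≠ 0 := by rw [← norm_pos_iff, hρ]; exact hr
  have hne := neBot_nhdsWithin_ball hr hρ
  have hp := hT.hasFPowerSeriesAt
  have hp1 := hp.has_fpower_series_dslope_fslope
  have hp2 := hp1.has_fpower_series_dslope_fslope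
  have hd1 : ∀ x, T x - T τ = (x - τ) * dslope T τ x := fun x => by
    simpa using (sub_smul_dslope T τ x).symm
  have hd2 : ∀ x, dslope T τ x - dslope T τ τ = (x - τ) * dslope (dslope T τ) τ x := fun x => by
    simpa using (sub_smul_dslope (dslope T τ) τ x).symm
  have hmem : ∀ᶠ y in 𝓝[ball 0 r] ρ, y ∈ ball (0 : ℂ) r := self_mem_nhdsWithin
  have hw : ∀ᶠ y in 𝓝[ball 0 r] ρ, (1 - y / ρ) ^ (1 / 2 : ℂ) ≠ 0 := by
    filter_upwards [hmem] with y hy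
    have := one_sub_ne_zero_of_norm_lt (norm_div_lt_one_of_mem_ball hr hρ hy)
    simp [Complex.cpow_eq_zero_iff, this]
  have hfne : ∀ᶠ y in 𝓝[ball 0 r] ρ, f y - τ ≠ 0 := by
    filter_upwards [hfc.eventually_ne hc] with y hy h
    simp [h] at hy
  have hy : Tendsto (fun y : ℂ => y) (𝓝[ball 0 r] ρ) (𝓝 ρ) := tendsto_id.mono_left nhdsWithin_le_nhds
  have hu : Tendsto (fun y : ℂ => y / ρ) (𝓝[ball 0 r] ρ) (𝓝 1) := by
    have := hy.div_const ρ
    rwa [div_self hρ0] at this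
  have hw0 : Tendsto (fun y : ℂ => (1 - y / ρ) ^ (1 / 2 : ℂ)) (𝓝[ball 0 r] ρ) (𝓝 0) := by
    have h1 : Tendsto (fun y : ℂ => 1 - y / ρ) (𝓝[ball 0 r] ρ) (𝓝 0) := by
      simpa using hu.const_sub 1
    have h2 := (Complex.continuousAt_cpow_zero_of_re_pos (z := (1 / 2 : ℂ)) (by norm_num))
    have h3 : Tendsto (fun y : ℂ => ((1 - y / ρ), (1 / 2 : ℂ))) (𝓝[ball 0 r] ρ)
        (𝓝 (0, (1 / 2 : ℂ))) := h1.prodMk_nhds tendsto_const_nhds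
    have h4 := h2.tendsto.comp h3
    simpa [Function.comp_def] using h4
  have hquo := hfc.inv₀ hc
  -- On the curve `T(x(y)) - T τ = (ρ² - y²)/2`, which vanishes like `w²`, while `x(y) - τ` vanishes
  -- only like `w`. One division by `x(y) - τ` shows that the slope tends to `0`; a second one finds
  -- the quadratic coefficient.
  have hTy : ∀ᶠ y in 𝓝[ball 0 r] ρ, (f y - τ) * dslope T τ (f y) =
      ρ ^ 2 / 2 * (1 + y / ρ) * ((1 - y / ρ) ^ (1 / 2 : ℂ)) ^ 2 := by
    filter_upwards [hcont] with y h1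
    rw [← hd1, cpow_half_sq]
    have : ρ ^ 2 / 2 * (1 + y / ρ) * (1 - y / ρ) = ρ ^ 2 / 2 - y ^ 2 / 2 := by field_simp; ring
    rw [this, h1, hTτ]; ring
  have hlim1 : Tendsto (fun y => dslope T τ (f y)) (𝓝[ball 0 r] ρ) (𝓝 (dslope T τ τ)) :=
    hp1.continuousAt.tendsto.comp hf
  have hlim2 : Tendsto (fun y => ρ ^ 2 / 2 * (1 + y / ρ) * (1 - y / ρ) ^ (1 / 2 : ℂ) *
      ((f y - τ) / (1 - y / ρ) ^ (1 / 2 : ℂ))⁻¹) (𝓝[ball 0 r] ρ) (𝓝 0) := by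
    have := ((((hu.const_add 1).const_mul (ρ ^ 2 / 2)).mul hw0).mul hquo)
    simpa using this
  have hT1 : dslope T τ τ = 0 := by
    refine tendsto_nhds_unique hlim1 (hlim2.congr' ?_)
    filter_upwards [hTy, hw, hfne] with y h1 h2 h3
    rw [inv_div]
    generalize (1 - y / ρ) ^ (1 / 2 : ℂ) = w at h1 h2 ⊢
    generalize 1 + y / ρ = v at h1 ⊢
    field_simp
    linear_combination -2 * h1
  have hd2' : ∀ x, dslope T τ x = (x - τ) * dslope (dslope T τ) τ x := fun x => by
    rw [← hd2, hT1, sub_zero]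
  have hlim3 : Tendsto (fun y => dslope (dslope T τ) τ (f y)) (𝓝[ball 0 r] ρ)
      (𝓝 (dslope (dslope T τ) τ τ)) := hp2.continuousAt.tendsto.comp hf
  have hlim4 : Tendsto (fun y => ρ ^ 2 / 2 * (1 + y / ρ) *
      (((f y - τ) / (1 - y / ρ) ^ (1 / 2 : ℂ))⁻¹) ^ 2) (𝓝[ball 0 r] ρ) (𝓝 (ρ ^ 2 / c ^ 2)) := by
    have := (((hu.const_add 1).const_mul (ρ ^ 2 / 2)).mul (hquo.pow 2))
    convert this using 2
    field_simp
    norm_num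
  have hqτ : dslope (dslope T τ) τ τ = ρ ^ 2 / c ^ 2 := by
    refine tendsto_nhds_unique hlim3 (hlim4.congr' ?_)
    filter_upwards [hTy, hw, hfne] with y h1 h2 h3
    rw [hd2'] at h1
    rw [inv_div]
    generalize (1 - y / ρ) ^ (1 / 2 : ℂ) = w at h1 h2 ⊢
    generalize 1 + y / ρ = v at h1 ⊢
    field_simp
    linear_combination -2 * h1
  refine ⟨dslope (dslope T τ) τ, hp2.analyticAt, fun x => ?_, hqτ, ?_, ?_⟩
  · rw [hd1, hd2']; ring
  · have h1 : PowerSeries.coeff 1 (shiftedAction T τ) = deriv T τ := by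
      simp [shiftedAction, iteratedDeriv_one]
    rw [h1, ← dslope_same, hT1]
  · have h1 : PowerSeries.coeff 2 (shiftedAction T τ) = PowerSeries.coeff 2 (taylorSeries T τ) := by
      simp [shiftedAction, taylorSeries]
    rw [h1, coeff_taylorSeries_of_hasFPowerSeriesAt hp, ← hp2.coeff_zero 1]
    change _ = FormalMultilinearSeries.coeff _ 0
    rw [FormalMultilinearSeries.coeff_fslope, FormalMultilinearSeries.coeff_fslope]

/-- Near a singularity, `x (y)` is an analytic function of `√(y ^ 2 - ρ ^ 2)`, which inverts the
curve at its end point. -/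
theorem exists_local_uniformization {f : ℂ → ℂ} {r : ℝ} (hr : 0 < r) {τ ρ : ℂ} (hρ : ‖ρ‖ = r)
    {T : ℂ → ℂ} (hsqrt : IsSquareRootAt f r τ ρ) (hreg : IsRegularPoint T τ ρ)
    (hcont : ContinuesActionAlong f r ρ T) :
    IsAction (shiftedAction T τ) ∧ ∃ s : ℂ, IsContinuedBranch f r τ ρ T s ∧
      ∃ X : ℂ → ℂ, AnalyticAt ℂ X 0 ∧ X 0 = τ ∧ deriv X 0 = s ∧ s ≠ 0 ∧
        (∀ᶠ z in 𝓝 0, z ^ 2 / 2 = -(T (X z) - T τ)) ∧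
        ∀ᶠ y in 𝓝[ball 0 r] ρ,
          f y = X (Complex.I * ρ * ((1 - y / ρ) ^ (1 / 2 : ℂ) * (1 + y / ρ) ^ (1 / 2 : ℂ))) := by
  obtain ⟨hf, c, hc, hfc⟩ := hsqrt
  obtain ⟨hT, hTτ, -⟩ := hreg
  obtain ⟨q, hq, hTq, hqτ, hs1, hs2⟩ := exists_quadratic_factor hr hρ hf hc hfc hT hTτ hcont
  have hρ0 : ρ ≠ 0 := by rw [← norm_pos_iff, hρ]; exact hr
  have hne := neBot_nhdsWithin_ball hr hρ
  have hqτ0 : q τ ≠ 0 := by rw [hqτ]; positivity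
  have hI : Complex.I ≠ 0 := Complex.I_ne_zero
  have h2 : (2 : ℂ) ^ (1 / 2 : ℂ) ≠ 0 := by simp [Complex.cpow_eq_zero_iff]
  -- The factor `√2` comes from `√(1 + y/ρ)` at `y = ρ`.
  obtain ⟨s, hs⟩ : ∃ s : ℂ, s = c / (Complex.I * ρ * 2 ^ (1 / 2 : ℂ)) := ⟨_, rfl⟩
  have hs0 : s ≠ 0 := by rw [hs]; positivity
  have hsq : s ^ 2 * (2 * q τ) = -1 := by
    rw [hs, hqτ, div_pow, mul_pow, mul_pow, cpow_half_sq, Complex.I_sq]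
    field_simp
  have hmem : ∀ᶠ y in 𝓝[ball 0 r] ρ, y ∈ ball (0 : ℂ) r := self_mem_nhdsWithin
  have hu : Tendsto (fun y : ℂ => y / ρ) (𝓝[ball 0 r] ρ) (𝓝 1) := by
    have h : Tendsto (fun y : ℂ => y) (𝓝[ball 0 r] ρ) (𝓝 ρ) :=
      tendsto_id.mono_left nhdsWithin_le_nhds
    have := h.div_const ρ
    rwa [div_self hρ0] at this
  have hlim : Tendsto (fun y => (f y - τ) /
      (Complex.I * ρ * ((1 - y / ρ) ^ (1 / 2 : ℂ) * (1 + y / ρ) ^ (1 / 2 : ℂ))))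
      (𝓝[ball 0 r] ρ) (𝓝 s) := by
    have h3 : Tendsto (fun y : ℂ => (1 + y / ρ) ^ (1 / 2 : ℂ)) (𝓝[ball 0 r] ρ)
        (𝓝 ((2 : ℂ) ^ (1 / 2 : ℂ))) := by
      have h4 : Tendsto (fun y : ℂ => 1 + y / ρ) (𝓝[ball 0 r] ρ) (𝓝 2) := by
        have := hu.const_add 1
        rwa [one_add_one_eq_two] at this
      exact h4.cpow tendsto_const_nhds (by simp)
    have := hfc.div (h3.const_mul (Complex.I * ρ)) (by positivity)
    rw [← hs] at this
    refine this.congr fun y => ?_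
    rw [Pi.div_apply, div_div]; congr 1; ring
  refine ⟨⟨by simp [shiftedAction], hs1, by rwa [hs2]⟩, s, ⟨?_, ?_⟩, ?_⟩
  · rw [covariance, hs2]
    have : (2 * q τ) * (2 * q τ)⁻¹ = 1 := mul_inv_cancel₀ (mul_ne_zero two_ne_zero hqτ0)
    linear_combination (2 * q τ)⁻¹ * hsq - s ^ 2 * this
  · refine hlim.congr' ?_
    filter_upwards [hmem] with y hy
    rw [← div_pow, one_sub_sq_cpow (norm_div_lt_one_of_mem_ball hr hρ hy)]
  -- The normalisation by `s` makes the radicand `1` at `τ`, away from the cut of the principal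
  -- root. Then `h = (x - τ)k` is an analytic square root of `-2(T - T τ)` with `h'(τ) = 1/s`.
  obtain ⟨k, hk⟩ : ∃ k : ℂ → ℂ, k = fun x => s⁻¹ * (-(2 * s ^ 2) * q x) ^ (1 / 2 : ℂ) := ⟨_, rfl⟩
  have hone : -(2 * s ^ 2) * q τ = 1 := by linear_combination -hsq
  have hkτ : k τ = s⁻¹ := by rw [hk]; simp only [hone]; simp
  have hka : AnalyticAt ℂ k τ := by
    rw [hk]
    refine analyticAt_const.fun_mul (AnalyticAt.cpow (analyticAt_const.fun_mul hq) analyticAt_const ?_)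
    rw [hone]; simp [Complex.mem_slitPlane_iff]
  obtain ⟨h, hh⟩ : ∃ h : ℂ → ℂ, h = fun x => (x - τ) * k x := ⟨_, rfl⟩
  have hha : AnalyticAt ℂ h τ := by
    rw [hh]; exact (analyticAt_id.fun_sub analyticAt_const).fun_mul hka
  have hhτ : h τ = 0 := by rw [hh]; simp
  have hhd : deriv h τ = s⁻¹ := by
    have h3 : HasDerivAt h (1 * k τ + (τ - τ) * deriv k τ) τ := by
      rw [hh]
      exact ((hasDerivAt_id τ).sub_const τ).mul hka.differentiableAt.hasDerivAt
    rw [h3.deriv, hkτ]; simp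
  have hhd0 : deriv h τ ≠ 0 := by rw [hhd]; exact inv_ne_zero hs0
  have hhsq : ∀ x, h x ^ 2 = -2 * (T x - T τ) := by
    intro x
    rw [hh, hTq, hk]
    simp only [mul_pow, cpow_half_sq]
    field_simp
  have hstrict := hha.hasStrictDerivAt
  set X := hstrict.localInverse h (deriv h τ) τ hhd0 with hX
  have hleft : ∀ᶠ x in 𝓝 τ, X (h x) = x := hstrict.eventually_left_inverse hhd0
  have hright : ∀ᶠ z in 𝓝 (h τ), h (X z) = z := hstrict.eventually_right_inverse hhd0
  have hXa : AnalyticAt ℂ X (h τ) := hha.analyticAt_localInverse hhd0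
  have hXd : HasStrictDerivAt X (deriv h τ)⁻¹ (h τ) := hstrict.to_localInverse hhd0
  rw [hhτ] at hright hXa hXd
  have hX0 : X 0 = τ := by
    have := hleft.self_of_nhds
    rwa [hhτ] at this
  refine ⟨X, hXa, hX0, ?_, hs0, ?_, ?_⟩
  · rw [hXd.hasDerivAt.deriv, hhd, inv_inv]
  · filter_upwards [hright] with z hz
    have := hhsq (X z)
    rw [hz] at this
    linear_combination this / 2
  · set z : ℂ → ℂ := fun y =>
      Complex.I * ρ * ((1 - y / ρ) ^ (1 / 2 : ℂ) * (1 + y / ρ) ^ (1 / 2 : ℂ)) with hz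
    have hratio : Tendsto (fun y => h (f y) / z y) (𝓝[ball 0 r] ρ) (𝓝 1) := by
      have h3 : Tendsto (fun y => k (f y)) (𝓝[ball 0 r] ρ) (𝓝 (k τ)) :=
        hka.continuousAt.tendsto.comp hf
      have h4 := hlim.mul h3
      rw [hkτ, mul_inv_cancel₀ hs0] at h4
      refine h4.congr fun y => ?_
      rw [hh]; simp only [hz]; ring
    -- The curve equation determines `h(x(y))` only up to sign; the limit `1` of the ratio excludes
    -- the wrong sign near `ρ`.
    have hnear : ∀ᶠ y in 𝓝[ball 0 r] ρ, h (f y) / z y ≠ -1 :=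
      hratio.eventually_ne (by norm_num)
    filter_upwards [hmem, hcont, hnear, hf.eventually hleft] with y hy h3 h4 h5
    have hu1 := norm_div_lt_one_of_mem_ball hr hρ hy
    have hw1 : (1 - y / ρ) ^ (1 / 2 : ℂ) ≠ 0 := by
      simp [Complex.cpow_eq_zero_iff, one_sub_ne_zero_of_norm_lt hu1]
    have hw2 : (1 + y / ρ) ^ (1 / 2 : ℂ) ≠ 0 := by
      have := one_sub_ne_zero_of_norm_lt (u := -(y / ρ)) (by rwa [norm_neg])
      rw [sub_neg_eq_add] at this
      simp [Complex.cpow_eq_zero_iff, this]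
    have hz0 : z y ≠ 0 := by simp only [hz]; positivity
    have hzsq : h (f y) ^ 2 = z y ^ 2 := by
      rw [hhsq]
      simp only [hz, mul_pow, cpow_half_sq, Complex.I_sq]
      have : ρ ^ 2 * ((1 - y / ρ) * (1 + y / ρ)) = ρ ^ 2 - y ^ 2 := by field_simp; ring
      linear_combination this - 2 * h3 + 2 * hTτ
    have heq : h (f y) = z y := by
      rcases sq_eq_sq_iff_eq_or_eq_neg.1 hzsq with h6 | h6
      · exact h6
      · rw [h6, neg_div, div_self hz0] at h4
        exact absurd rfl h4
    have h6 : X (z y) = f y := by rw [← heq, h5]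
    exact h6.symm

/-- The formal integral at the end point, in terms of the local uniformization. -/
theorem coeff_formalIntegral_shiftedAction {T X : ℂ → ℂ} {τ : ℂ} (hT : AnalyticAt ℂ T τ)
    (hact : IsAction (shiftedAction T τ)) (hX : AnalyticAt ℂ X 0) (hX0 : X 0 = τ)
    (hXd : deriv X 0 ≠ 0) (heq : ∀ᶠ z in 𝓝 0, z ^ 2 / 2 = -(T (X z) - T τ)) (n : ℕ) :
    PowerSeries.coeff n (formalIntegral (deriv X 0) (shiftedAction T τ)) =
      (Nat.doubleFactorial (2 * n + 1) : ℂ) * PowerSeries.coeff (2 * n + 1) (taylorSeries X 0) := by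
  obtain ⟨x, hx⟩ : ∃ x : ℂ → ℂ, x = fun z => X z - τ := ⟨_, rfl⟩
  have hxa : AnalyticAt ℂ x 0 := by rw [hx]; exact hX.fun_sub analyticAt_const
  have hx0 : x 0 = 0 := by rw [hx]; simp [hX0]
  -- The algebraic formula needs a series without constant term; the shift by `τ` leaves all other
  -- coefficients unchanged.
  have hcoe : ∀ j, j ≠ 0 → PowerSeries.coeff j (taylorSeries x 0) =
      PowerSeries.coeff j (taylorSeries X 0) := by
    intro j hj
    have h1 : taylorSeries X 0 = taylorSeries x 0 + PowerSeries.C τ := by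
      rw [← taylorSeries_const τ 0, ← taylorSeries_add hxa analyticAt_const, hx]
      simp
    rw [h1, map_add, PowerSeries.coeff_C, if_neg hj, add_zero]
  obtain ⟨G, hG⟩ : ∃ G : ℂ → ℂ, G = fun z => -T τ + T (τ + z) := ⟨_, rfl⟩
  have hGa : AnalyticAt ℂ G 0 := by
    rw [hG]
    refine analyticAt_const.fun_add
      (AnalyticAt.fun_comp ?_ (analyticAt_const.fun_add analyticAt_id))
    simpa using hT
  have hGs : taylorSeries G 0 = shiftedAction T τ := by
    ext j
    rw [coeff_taylorSeries, shiftedAction, PowerSeries.coeff_mk, hG]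
    split_ifs with hj
    · subst hj; simp
    · congr 1
      rw [iteratedDeriv_const_add (Nat.pos_of_ne_zero hj), iteratedDeriv_comp_const_add]; simp
  have hsub := taylorSeries_comp hGa hxa hx0
  rw [hGs] at hsub
  have hcurve : PowerSeries.C (1 / 2 : ℂ) * PowerSeries.X ^ 2 =
      -(PowerSeries.subst (taylorSeries x 0) (shiftedAction T τ)) := by
    rw [← hsub]
    have h1 : (fun z => G (x z)) =ᶠ[𝓝 0] fun z => (-(1 / 2) : ℂ) * z ^ 2 := by
      filter_upwards [heq] with z hz
      rw [hG, hx]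
      simp only [add_sub_cancel]
      linear_combination hz
    have hid : AnalyticAt ℂ (fun z : ℂ => z) 0 := analyticAt_id
    rw [taylorSeries_congr h1, taylorSeries_mul analyticAt_const (hid.fun_pow 2),
      taylorSeries_const, taylorSeries_pow hid, taylorSeries_id]
    simp
  have h1 : PowerSeries.coeff 1 (taylorSeries x 0) = deriv X 0 := by
    rw [hcoe 1 one_ne_zero, coeff_taylorSeries]; simp [iteratedDeriv_one]
  have h2 := (coeff_formalIntegral hact (x := taylorSeries x 0) (by simp [coeff_taylorSeries, hx0])
    (by rwa [h1]) hcurve n).1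
  rw [h1, hcoe _ (by omega)] at h2
  exact h2

end LocalInversion

/-! ### Singular parts and their coefficients. -/

section SingularPart

open Metric

/-- The principal branch of `√(1 - y / ρ)`. -/
def sqrtOneSub (ρ y : ℂ) : ℂ := (1 - y / ρ) ^ (1 / 2 : ℂ)

theorem sqrtOneSub_sq (ρ y : ℂ) : sqrtOneSub ρ y ^ 2 = 1 - y / ρ := cpow_half_sq _

theorem sqrtOneSub_ne_zero {r : ℝ} {ρ y : ℂ} (hr : 0 < r) (hρ : ‖ρ‖ = r)
    (hy : y ∈ ball (0 : ℂ) r) : sqrtOneSub ρ y ≠ 0 := by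
  have := one_sub_ne_zero_of_norm_lt (norm_div_lt_one_of_mem_ball hr hρ hy)
  simp [sqrtOneSub, Complex.cpow_eq_zero_iff, this]

theorem one_sub_div_mem_slitPlane {ρ ζ : ℂ} (hρ : ρ ≠ 0) (hζ : ‖ζ‖ ≤ ‖ρ‖) (h : ζ ≠ ρ) :
    1 - ζ / ρ ∈ Complex.slitPlane := by
  rw [Complex.mem_slitPlane_iff]
  by_contra! hcon
  obtain ⟨h1, h2⟩ := hcon
  have h3 : ‖ζ / ρ‖ ≤ 1 := by
    rw [norm_div]; exact div_le_one_of_le₀ hζ (norm_nonneg _)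
  have h4 : (ζ / ρ).re ≤ 1 := (le_abs_self _).trans ((Complex.abs_re_le_norm _).trans h3)
  simp only [Complex.sub_re, Complex.one_re, Complex.sub_im, Complex.one_im] at h1 h2
  have h5 : ζ / ρ = 1 := Complex.ext (by simp; linarith) (by simp; linarith)
  exact h ((div_eq_one_iff_eq hρ).1 h5)

theorem analyticAt_sqrtOneSub {ρ ζ : ℂ} (hρ : ρ ≠ 0) (hζ : ‖ζ‖ ≤ ‖ρ‖) (h : ζ ≠ ρ) :
    AnalyticAt ℂ (sqrtOneSub ρ) ζ := by
  have hid : AnalyticAt ℂ (fun y : ℂ => y) ζ := analyticAt_id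
  exact AnalyticAt.cpow (analyticAt_const.fun_sub (hid.fun_div analyticAt_const hρ))
    analyticAt_const (one_sub_div_mem_slitPlane hρ hζ h)

theorem analyticAt_sqrtOneSub_of_mem_ball {r : ℝ} {ρ y : ℂ} (hr : 0 < r) (hρ : ‖ρ‖ = r)
    (hy : y ∈ ball (0 : ℂ) r) : AnalyticAt ℂ (sqrtOneSub ρ) y := by
  have hy' : ‖y‖ < ‖ρ‖ := by rw [hρ]; exact mem_ball_zero_iff.1 hy
  refine analyticAt_sqrtOneSub (by rw [← norm_pos_iff, hρ]; exact hr) hy'.le ?_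
  rintro rfl
  exact lt_irrefl _ hy'

theorem hasDerivAt_sqrtOneSub {ρ y : ℂ} (hρ : ρ ≠ 0) (h : AnalyticAt ℂ (sqrtOneSub ρ) y)
    (h0 : sqrtOneSub ρ y ≠ 0) :
    HasDerivAt (sqrtOneSub ρ) (-(2 * ρ)⁻¹ * (sqrtOneSub ρ y)⁻¹) y := by
  have h1 : HasDerivAt (fun z => sqrtOneSub ρ z ^ 2)
      (((2 : ℕ) : ℂ) * sqrtOneSub ρ y ^ (2 - 1) * deriv (sqrtOneSub ρ) y) y :=
    h.differentiableAt.hasDerivAt.pow 2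
  have h2 : HasDerivAt (fun z => sqrtOneSub ρ z ^ 2) (-(1 / ρ)) y := by
    simp only [sqrtOneSub_sq]
    exact ((hasDerivAt_id y).div_const ρ).const_sub 1
  have h3 := h1.unique h2
  have h4 : deriv (sqrtOneSub ρ) y = -(2 * ρ)⁻¹ * (sqrtOneSub ρ y)⁻¹ := by
    field_simp
    field_simp at h3
    norm_num at h3
    linear_combination h3
  rw [← h4]
  exact h.differentiableAt.hasDerivAt

theorem tendsto_sqrtOneSub {r : ℝ} {ρ : ℂ} (hr : 0 < r) (hρ : ‖ρ‖ = r) :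
    Tendsto (sqrtOneSub ρ) (𝓝[ball 0 r] ρ) (𝓝 0) := by
  have hρ0 : ρ ≠ 0 := by rw [← norm_pos_iff, hρ]; exact hr
  have h1 : Tendsto (fun y : ℂ => 1 - y / ρ) (𝓝[ball 0 r] ρ) (𝓝 0) := by
    have hy : Tendsto (fun y : ℂ => y) (𝓝[ball 0 r] ρ) (𝓝 ρ) :=
      tendsto_id.mono_left nhdsWithin_le_nhds
    have := (hy.div_const ρ).const_sub 1
    rwa [div_self hρ0, sub_self] at this
  have h2 := (Complex.continuousAt_cpow_zero_of_re_pos (z := (1 / 2 : ℂ)) (by norm_num))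
  have h3 : Tendsto (fun y : ℂ => ((1 - y / ρ), (1 / 2 : ℂ))) (𝓝[ball 0 r] ρ)
      (𝓝 (0, (1 / 2 : ℂ))) := h1.prodMk_nhds tendsto_const_nhds
  have h4 : Tendsto (sqrtOneSub ρ) (𝓝[ball 0 r] ρ) (𝓝 ((0 : ℂ) ^ (1 / 2 : ℂ))) :=
    h2.tendsto.comp h3
  rwa [Complex.zero_cpow (by norm_num)] at h4

/-- Differentiating an analytic function of `√(1 - y / ρ)` lowers the order of vanishing by two. -/
theorem exists_iteratedDeriv_pow_mul_sqrtOneSub {r : ℝ} {ρ : ℂ} (hr : 0 < r) (hρ : ‖ρ‖ = r)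
    (K : ℕ) {Y : ℂ → ℂ} (hY : AnalyticAt ℂ Y 0) :
    ∃ Z : ℂ → ℂ, AnalyticAt ℂ Z 0 ∧
      iteratedDeriv K (fun y => sqrtOneSub ρ y ^ (2 * K) * Y (sqrtOneSub ρ y))
        =ᶠ[𝓝[ball 0 r] ρ] fun y => Z (sqrtOneSub ρ y) := by
  have hρ0 : ρ ≠ 0 := by rw [← norm_pos_iff, hρ]; exact hr
  induction K generalizing Y with
  | zero => exact ⟨Y, hY, by simp⟩
  | succ K ih =>
    -- From `w' = -1/(2ρw)`: the derivative of `w^(2K+2) Y(w)` is `w^(2K) Y₁(w)`.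
    obtain ⟨Y₁, hY₁⟩ : ∃ Y₁ : ℂ → ℂ, Y₁ = fun w =>
      -(2 * ρ)⁻¹ * ((2 * (K + 1) : ℕ) * Y w + w * deriv Y w) := ⟨_, rfl⟩
    have hid : AnalyticAt ℂ (fun w : ℂ => w) 0 := analyticAt_id
    have hY₁a : AnalyticAt ℂ Y₁ 0 := by
      rw [hY₁]
      exact analyticAt_const.fun_mul
        ((analyticAt_const.fun_mul hY).fun_add (hid.fun_mul hY.deriv))
    obtain ⟨Z, hZ, h⟩ := ih hY₁a
    refine ⟨Z, hZ, EventuallyEq.trans ?_ h⟩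
    rw [iteratedDeriv_succ']
    refine eventuallyEq_iteratedDeriv_of_nhdsWithin isOpen_ball ?_ K
    filter_upwards [(tendsto_sqrtOneSub hr hρ).eventually hY.eventually_analyticAt,
      self_mem_nhdsWithin] with y hYy hy
    have h0 := sqrtOneSub_ne_zero hr hρ hy
    have hw := hasDerivAt_sqrtOneSub hρ0 (analyticAt_sqrtOneSub_of_mem_ball hr hρ hy) h0
    have h1 := (hw.fun_pow (2 * (K + 1))).fun_mul (hYy.differentiableAt.hasDerivAt.comp y hw)
    have h2 : deriv (fun y => sqrtOneSub ρ y ^ (2 * (K + 1)) * Y (sqrtOneSub ρ y)) y = _ := h1.deriv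
    rw [h2, hY₁, show 2 * (K + 1) - 1 = 2 * K + 1 by omega]
    simp only [Function.comp_def]
    generalize sqrtOneSub ρ y = w at h0
    rw [show 2 * (K + 1) = 2 * K + 2 by ring]
    field_simp
    ring

theorem sum_range_two_mul (g : ℕ → ℂ) (K : ℕ) :
    ∑ j ∈ Finset.range (2 * K), g j =
      ∑ l ∈ Finset.range K, g (2 * l) + ∑ l ∈ Finset.range K, g (2 * l + 1) := by
  induction K with
  | zero => simp
  | succ K ih =>
    rw [show 2 * (K + 1) = 2 * K + 1 + 1 by ring, Finset.sum_range_succ, Finset.sum_range_succ, ih,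
      Finset.sum_range_succ, Finset.sum_range_succ]
    ring

/-- Removing the odd powers of `√(1 - y / ρ)` from a function that is analytic in `√(1 - y / ρ)`
leaves a function with bounded derivatives. -/
theorem isBigO_iteratedDeriv_sub_singular {f : ℂ → ℂ} {r : ℝ} {ρ : ℂ} (hr : 0 < r) (hρ : ‖ρ‖ = r)
    {Ψ : ℂ → ℂ} (hΨ : AnalyticAt ℂ Ψ 0)
    (hf : f =ᶠ[𝓝[ball 0 r] ρ] fun y => Ψ (sqrtOneSub ρ y)) (K : ℕ) :
    iteratedDeriv K (fun y => f y - ∑ l ∈ Finset.range K,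
        PowerSeries.coeff (2 * l + 1) (taylorSeries Ψ 0) * sqrtOneSub ρ y ^ (2 * l + 1))
      =O[𝓝[ball 0 r] ρ] fun _ => (1 : ℝ) := by
  have hρ0 : ρ ≠ 0 := by rw [← norm_pos_iff, hρ]; exact hr
  obtain ⟨Y, hY, -, hΨY⟩ := exists_taylor_remainder hΨ (2 * K)
  obtain ⟨Z, hZ, hZeq⟩ := exists_iteratedDeriv_pow_mul_sqrtOneSub hr hρ K hY
  -- The even powers of `w` form a polynomial in `y`, and the remainder `w^(2K) Y(w)` survives `K`
  -- derivatives.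
  obtain ⟨P, hP⟩ : ∃ P : ℂ → ℂ, P = fun y => ∑ l ∈ Finset.range K,
    PowerSeries.coeff (2 * l) (taylorSeries Ψ 0) * (1 - y / ρ) ^ l := ⟨_, rfl⟩
  have hPa : ∀ z, AnalyticAt ℂ P z := by
    intro z
    have hid : AnalyticAt ℂ (fun w : ℂ => w) z := analyticAt_id
    rw [hP]
    exact Finset.analyticAt_fun_sum _ fun l _ => analyticAt_const.fun_mul
      ((analyticAt_const.fun_sub (hid.fun_div analyticAt_const hρ0)).fun_pow l)
  have heq : (fun y => f y - ∑ l ∈ Finset.range K,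
        PowerSeries.coeff (2 * l + 1) (taylorSeries Ψ 0) * sqrtOneSub ρ y ^ (2 * l + 1))
      =ᶠ[𝓝[ball 0 r] ρ]
        fun y => P y + sqrtOneSub ρ y ^ (2 * K) * Y (sqrtOneSub ρ y) := by
    filter_upwards [hf] with y hy
    rw [hy, hΨY, hP, sum_range_two_mul]
    have hev : ∀ l, sqrtOneSub ρ y ^ (2 * l) = (1 - y / ρ) ^ l := fun l => by
      rw [pow_mul, sqrtOneSub_sq]
    simp only [sub_zero, hev]
    ring
  have h1 := eventuallyEq_iteratedDeriv_of_nhdsWithin isOpen_ball heq K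
  have h2 : iteratedDeriv K (fun y => P y + sqrtOneSub ρ y ^ (2 * K) * Y (sqrtOneSub ρ y))
      =ᶠ[𝓝[ball 0 r] ρ] fun y => iteratedDeriv K P y + Z (sqrtOneSub ρ y) := by
    filter_upwards [hZeq, (tendsto_sqrtOneSub hr hρ).eventually hY.eventually_analyticAt,
      self_mem_nhdsWithin] with y h3 h4 hy
    have h5 := analyticAt_sqrtOneSub_of_mem_ball hr hρ hy
    rw [iteratedDeriv_fun_add (hPa y).contDiffAt
      ((h5.fun_pow _).fun_mul (AnalyticAt.fun_comp h4 h5)).contDiffAt, h3]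
  refine IsBigO.congr' ?_ (h1.trans h2).symm EventuallyEq.rfl
  refine IsBigO.add ?_ ?_
  · exact ((analyticAt_iteratedDeriv (hPa ρ) K).continuousAt.isBigO_one ℝ).mono nhdsWithin_le_nhds
  · exact (hZ.continuousAt.isBigO_one ℝ).comp_tendsto (tendsto_sqrtOneSub hr hρ)

theorem isBigO_iteratedDeriv_sub_of_analyticAt {f g : ℂ → ℂ} {r : ℝ} {ζ : ℂ} (K : ℕ)
    (hf : ∀ y ∈ ball (0 : ℂ) r, AnalyticAt ℂ f y) (hg : ∀ y ∈ ball (0 : ℂ) r, AnalyticAt ℂ g y)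
    (hfK : iteratedDeriv K f =O[𝓝[ball 0 r] ζ] fun _ => (1 : ℝ)) (hgζ : AnalyticAt ℂ g ζ) :
    iteratedDeriv K (fun y => f y - g y) =O[𝓝[ball 0 r] ζ] fun _ => (1 : ℝ) := by
  have hgK := isBigO_iteratedDeriv_of_analyticAt (isOpen_ball (x := (0 : ℂ)) (ε := r))
    (EventuallyEq.rfl (f := g)) hgζ K
  refine IsBigO.congr' (hfK.sub hgK) ?_ EventuallyEq.rfl
  filter_upwards [self_mem_nhdsWithin] with y hy
  rw [iteratedDeriv_fun_sub (hf y hy).contDiffAt (hg y hy).contDiffAt]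

theorem taylorSeries_sub {f g : ℂ → ℂ} {c : ℂ} (hf : AnalyticAt ℂ f c) (hg : AnalyticAt ℂ g c) :
    taylorSeries (fun z => f z - g z) c = taylorSeries f c - taylorSeries g c := by
  ext n
  rw [map_sub, coeff_taylorSeries, coeff_taylorSeries, coeff_taylorSeries,
    iteratedDeriv_fun_sub hf.contDiffAt hg.contDiffAt, sub_div]

/-- The coefficients of `(1 - u) ^ (l + 1 / 2)`. -/
def halfBinomial (l m : ℕ) : ℝ :=
  (-1) ^ (l + 1) / Real.pi *
    (Real.Gamma (m - l - 1 / 2) * Real.Gamma (l + 3 / 2) / m.factorial)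

/-- The reflection formula at `l + 3/2`, where the sine is `(-1)^(l+1)`. The definition is in Gamma
form, rather than as a binomial coefficient, so as to match a Beta integral. -/
theorem halfBinomial_zero (l : ℕ) : halfBinomial l 0 = 1 := by
  have h1 := Real.Gamma_mul_Gamma_one_sub ((l : ℝ) + 3 / 2)
  have h2 : Real.sin (Real.pi * ((l : ℝ) + 3 / 2)) = (-1) ^ (l + 1) := by
    have : Real.pi * ((l : ℝ) + 3 / 2) = Real.pi / 2 + ((l + 1 : ℕ) : ℝ) * Real.pi := by
      push_cast; ring
    rw [this, Real.sin_add_nat_mul_pi, Real.sin_pi_div_two, mul_one]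
  have h3 : (1 : ℝ) - ((l : ℝ) + 3 / 2) = ((0 : ℕ) : ℝ) - l - 1 / 2 := by push_cast; ring
  have h4 : ((-1 : ℝ) ^ (l + 1)) * (-1) ^ (l + 1) = 1 := by
    rw [← mul_pow]; simp
  rw [h2, h3] at h1
  rw [halfBinomial, mul_comm (Real.Gamma _), h1]
  have h5 : ((-1 : ℝ) ^ (l + 1)) ≠ 0 := by positivity
  field_simp
  simp

theorem halfBinomial_succ (l m : ℕ) :
    ((m : ℝ) + 1) * halfBinomial l (m + 1) = (m - l - 1 / 2) * halfBinomial l m := by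
  have h1 : (m : ℝ) - l - 1 / 2 ≠ 0 := by
    intro h
    have h2 : (2 * m : ℝ) = 2 * l + 1 := by linarith
    have h3 : 2 * m = 2 * l + 1 := by exact_mod_cast h2
    omega
  have h4 := Real.Gamma_add_one h1
  have h5 : ((m + 1 : ℕ) : ℝ) - l - 1 / 2 = (m - l - 1 / 2) + 1 := by push_cast; ring
  have h6 : (m.factorial : ℝ) ≠ 0 := by exact_mod_cast m.factorial_ne_zero
  rw [halfBinomial, halfBinomial, h5, h4, Nat.factorial_succ]
  push_cast
  field_simp

/-- The function `g = (1 - y/ρ)^(l+1/2)` solves `(1 - y/ρ) g' = -(l + 1/2) ρ⁻¹ g`, and comparing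
coefficients gives the recursion of `halfBinomial_succ`. -/
theorem coeff_taylorSeries_sqrtOneSub_pow {ρ : ℂ} (hρ : ρ ≠ 0) (l m : ℕ) :
    PowerSeries.coeff m (taylorSeries (fun y => sqrtOneSub ρ y ^ (2 * l + 1)) 0) =
      (halfBinomial l m : ℂ) / ρ ^ m := by
  have hr : 0 < ‖ρ‖ := norm_pos_iff.2 hρ
  have h0 : (0 : ℂ) ∈ ball (0 : ℂ) ‖ρ‖ := by simpa using hr
  have hw := analyticAt_sqrtOneSub_of_mem_ball hr rfl h0
  obtain ⟨g, hg⟩ : ∃ g : ℂ → ℂ, g = fun y => sqrtOneSub ρ y ^ (2 * l + 1) := ⟨_, rfl⟩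
  have hga : AnalyticAt ℂ g 0 := by rw [hg]; exact hw.fun_pow _
  have hode : (fun y => (1 - y * ρ⁻¹) * deriv g y) =ᶠ[𝓝 0]
      fun y => (-(l + 1 / 2) * ρ⁻¹) * g y := by
    filter_upwards [isOpen_ball.mem_nhds h0] with y hy
    have hy0 := sqrtOneSub_ne_zero hr rfl hy
    have hd := (hasDerivAt_sqrtOneSub hρ (analyticAt_sqrtOneSub_of_mem_ball hr rfl hy) hy0).fun_pow
      (2 * l + 1)
    rw [hg, hd.deriv, ← div_eq_mul_inv y, ← sqrtOneSub_sq]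
    beta_reduce
    generalize sqrtOneSub ρ y = w at hy0
    rw [Nat.add_sub_cancel]
    push_cast
    field_simp
    ring
  have hid : AnalyticAt ℂ (fun y : ℂ => y) 0 := analyticAt_id
  have hode' := taylorSeries_congr hode
  rw [taylorSeries_mul analyticAt_const hga,
    taylorSeries_mul (analyticAt_const.fun_sub (hid.fun_mul analyticAt_const)) hga.deriv,
    taylorSeries_sub analyticAt_const (hid.fun_mul analyticAt_const),
    taylorSeries_mul hid analyticAt_const, taylorSeries_id] at hode'
  simp only [taylorSeries_const] at hode'
  have hdc : ∀ j : ℕ, PowerSeries.coeff j (taylorSeries (deriv g) 0) =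
      ((j : ℂ) + 1) * PowerSeries.coeff (j + 1) (taylorSeries g 0) := by
    intro j
    have h1 : (j.factorial : ℂ) ≠ 0 := by exact_mod_cast j.factorial_ne_zero
    have h2 : ((j : ℂ) + 1) ≠ 0 := by exact_mod_cast j.succ_ne_zero
    rw [coeff_taylorSeries, coeff_taylorSeries, iteratedDeriv_succ', Nat.factorial_succ]
    push_cast
    field_simp
  have hrec : ∀ j : ℕ, ((j : ℂ) + 1) * PowerSeries.coeff (j + 1) (taylorSeries g 0) =
      ((j : ℂ) - l - 1 / 2) * ρ⁻¹ * PowerSeries.coeff j (taylorSeries g 0) := by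
    intro j
    have h1 := congrArg (PowerSeries.coeff j) hode'
    rw [PowerSeries.coeff_C_mul, map_one, sub_mul, one_mul, map_sub, hdc, mul_assoc] at h1
    rcases j with _ | j
    · rw [PowerSeries.coeff_zero_X_mul] at h1
      linear_combination h1
    · rw [PowerSeries.coeff_succ_X_mul, PowerSeries.coeff_C_mul, hdc] at h1
      push_cast at h1 ⊢
      linear_combination h1
  rw [← hg]
  induction m with
  | zero =>
    rw [halfBinomial_zero, coeff_taylorSeries, hg]
    simp [sqrtOneSub]
  | succ m ih =>
    have h2 : ((m : ℂ) + 1) ≠ 0 := by exact_mod_cast m.succ_ne_zero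
    have h3 : ((m : ℂ) + 1) * (halfBinomial l (m + 1) : ℂ) = (m - l - 1 / 2) * halfBinomial l m := by
      have := congrArg (fun t : ℝ => (t : ℂ)) (halfBinomial_succ l m)
      push_cast at this
      exact this
    apply mul_left_cancel₀ h2
    rw [hrec, ih, ← mul_div_assoc ((m : ℂ) + 1), h3, pow_succ]
    field_simp

theorem taylorSeries_finset_sum {α : Type*} {f : α → ℂ → ℂ} {c : ℂ}
    (hf : ∀ j, AnalyticAt ℂ (f j) c) (s : Finset α) :
    taylorSeries (fun z => ∑ j ∈ s, f j z) c = ∑ j ∈ s, taylorSeries (f j) c := by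
  classical
  induction s using Finset.induction_on with
  | empty => simpa using taylorSeries_const 0 c
  | insert a s ha ih =>
    simp only [Finset.sum_insert ha]
    rw [taylorSeries_add (hf a) (Finset.analyticAt_fun_sum _ fun j _ => hf j), ih]

/-- The asymptotic expansion of the coefficients of a function with finitely many singularities on
its circle of convergence, each of which is analytic in a square root. -/
theorem isBigO_coeff_sub_halfBinomial {ι : Type*} [Fintype ι] {F : ℂ → ℂ} {r : ℝ} (hr : 0 < r)
    (hF : ∀ y ∈ ball (0 : ℂ) r, AnalyticAt ℂ F y) {ρ : ι → ℂ} (hinj : Function.Injective ρ)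
    (hρ : ∀ i, ‖ρ i‖ = r) (hdom : dominantSingularities F r ⊆ Set.range ρ)
    {Ψ : ι → ℂ → ℂ} (hΨ : ∀ i, AnalyticAt ℂ (Ψ i) 0)
    (hFΨ : ∀ i, F =ᶠ[𝓝[ball 0 r] (ρ i)] fun y => Ψ i (sqrtOneSub (ρ i) y)) (K : ℕ) :
    (fun m : ℕ => (PowerSeries.coeff m (taylorSeries F 0) - ∑ i, ∑ l ∈ Finset.range K,
        PowerSeries.coeff (2 * l + 1) (taylorSeries (Ψ i) 0) * ((halfBinomial l m : ℂ) / ρ i ^ m)) *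
          (r : ℂ) ^ m) =O[atTop] fun m : ℕ => ((m : ℝ) ^ K)⁻¹ := by
  classical
  have hρ0 : ∀ i, ρ i ≠ 0 := fun i => by rw [← norm_pos_iff, hρ]; exact hr
  -- The singular part at `ρ i`, analytic on the closed disc except at `ρ i`, because `1 - y/ρ i`
  -- stays in the slit plane.
  obtain ⟨σ, hσ⟩ : ∃ σ : ι → ℂ → ℂ, σ = fun i y => ∑ l ∈ Finset.range K,
    PowerSeries.coeff (2 * l + 1) (taylorSeries (Ψ i) 0) * sqrtOneSub (ρ i) y ^ (2 * l + 1) :=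
    ⟨_, rfl⟩
  have hσa : ∀ i ζ, ‖ζ‖ ≤ r → ζ ≠ ρ i → AnalyticAt ℂ (σ i) ζ := by
    intro i ζ hζ hne
    rw [hσ]
    exact Finset.analyticAt_fun_sum _ fun l _ => analyticAt_const.fun_mul
      ((analyticAt_sqrtOneSub (hρ0 i) (by rwa [hρ]) hne).fun_pow _)
  have hne : ∀ y ∈ ball (0 : ℂ) r, ∀ i, y ≠ ρ i := by
    rintro y hy i rfl
    rw [mem_ball_zero_iff, hρ] at hy
    exact lt_irrefl _ hy
  have hσball : ∀ i, ∀ y ∈ ball (0 : ℂ) r, AnalyticAt ℂ (σ i) y := fun i y hy =>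
    hσa i y (mem_ball_zero_iff.1 hy).le (hne y hy i)
  have hEa : ∀ y ∈ ball (0 : ℂ) r, AnalyticAt ℂ (fun z => F z - ∑ i, σ i z) y := fun y hy =>
    (hF y hy).fun_sub (Finset.analyticAt_fun_sum _ fun i _ => hσball i y hy)
  have hE := isBigO_coeff_of_iteratedDeriv hr K hEa ?_
  · refine hE.congr_left fun m => ?_
    have h0 : (0 : ℂ) ∈ ball (0 : ℂ) r := by simpa using hr
    have hs : ∀ i l, AnalyticAt ℂ (fun y => PowerSeries.coeff (2 * l + 1) (taylorSeries (Ψ i) 0) *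
        sqrtOneSub (ρ i) y ^ (2 * l + 1)) 0 := fun i l => analyticAt_const.fun_mul
      ((analyticAt_sqrtOneSub_of_mem_ball hr (hρ i) h0).fun_pow _)
    rw [← coeff_taylorSeries, taylorSeries_sub (hF 0 h0)
      (Finset.analyticAt_fun_sum _ fun i _ => hσball i 0 h0),
      taylorSeries_finset_sum (fun i => hσball i 0 h0), map_sub, map_sum, hσ]
    congr 2
    refine Finset.sum_congr rfl fun i _ => ?_
    rw [taylorSeries_finset_sum (hs i), map_sum]
    refine Finset.sum_congr rfl fun l _ => ?_
    rw [taylorSeries_mul analyticAt_const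
      ((analyticAt_sqrtOneSub_of_mem_ball hr (hρ i) h0).fun_pow _), taylorSeries_const,
      PowerSeries.coeff_C_mul, coeff_taylorSeries_sqrtOneSub_pow (hρ0 i)]
  · intro ζ hζ
    by_cases hmem : ζ ∈ Set.range ρ
    · obtain ⟨i, rfl⟩ := hmem
      -- At `ρ i` only `σ i` is singular, the points being distinct; it cancels the unbounded part
      -- of the derivative of `F`.
      have h1 : (fun z => F z - ∑ j, σ j z) =
          fun z => (F z - σ i z) - ∑ j ∈ Finset.univ.erase i, σ j z := by
        funext z
        rw [← Finset.add_sum_erase _ _ (Finset.mem_univ i)]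
        ring
      rw [h1]
      refine isBigO_iteratedDeriv_sub_of_analyticAt K
        (fun y hy => (hF y hy).fun_sub (hσball i y hy))
        (fun y hy => Finset.analyticAt_fun_sum _ fun j _ => hσball j y hy) ?_
        (Finset.analyticAt_fun_sum _ fun j hj => hσa j _ hζ.le ?_)
      · have := isBigO_iteratedDeriv_sub_singular hr (hρ i) (hΨ i) (hFΨ i) K
        rw [hσ]
        exact this
      · exact fun h => (Finset.ne_of_mem_erase hj) (hinj h.symm)
    · have hns : ζ ∉ dominantSingularities F r := fun h => hmem (hdom h)
      simp only [dominantSingularities, Set.mem_ofPred_eq, not_and, not_not] at hns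
      obtain ⟨g, hg, hgF⟩ := hns hζ
      refine isBigO_iteratedDeriv_sub_of_analyticAt K hF
        (fun y hy => Finset.analyticAt_fun_sum _ fun j _ => hσball j y hy)
        (isBigO_iteratedDeriv_of_analyticAt isOpen_ball
          (hgF.mono fun y hy => hy.symm) hg K)
        (Finset.analyticAt_fun_sum _ fun j _ => hσa j _ hζ.le ?_)
      rintro rfl
      exact hmem ⟨j, rfl⟩

end SingularPart

/-! ### Beta integrals along the cut. -/

section BetaIntegrals

open MeasureTheory Set

theorem betaIntegral_Ioo {a b : ℝ} (ha : 0 < a) (hb : 0 < b) :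
    IntegrableOn (fun v : ℝ => v ^ (a - 1) * (1 - v) ^ (b - 1)) (Ioo 0 1) ∧
      ∫ v in Ioo (0 : ℝ) 1, v ^ (a - 1) * (1 - v) ^ (b - 1) =
        Real.Gamma a * Real.Gamma b / Real.Gamma (a + b) := by
  have hcoe : EqOn (fun v : ℝ => (v : ℂ) ^ ((a : ℂ) - 1) * (1 - (v : ℂ)) ^ ((b : ℂ) - 1))
      (fun v : ℝ => ((v ^ (a - 1) * (1 - v) ^ (b - 1) : ℝ) : ℂ)) (Ioo 0 1) := by
    intro v hv
    have h1 : (0 : ℝ) ≤ 1 - v := by linarith [hv.2]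
    simp only [Complex.ofReal_mul]
    rw [Complex.ofReal_cpow hv.1.le, Complex.ofReal_cpow h1]
    push_cast
    rfl
  have hconv := Complex.betaIntegral_convergent (u := (a : ℂ)) (v := (b : ℂ)) (by simpa) (by simpa)
  rw [intervalIntegrable_iff_integrableOn_Ioc_of_le zero_le_one,
    integrableOn_Ioc_iff_integrableOn_Ioo, integrableOn_congr_fun hcoe measurableSet_Ioo] at hconv
  refine ⟨by have := hconv.re; simpa [IntegrableOn] using this, ?_⟩
  have hval := Complex.betaIntegral_eq_Gamma_mul_div (a : ℂ) (b : ℂ) (by simpa) (by simpa)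
  rw [Complex.betaIntegral, intervalIntegral.integral_of_le zero_le_one,
    integral_Ioc_eq_integral_Ioo, setIntegral_congr_fun measurableSet_Ioo hcoe, integral_complex_ofReal,
    ← Complex.ofReal_add, Complex.Gamma_ofReal, Complex.Gamma_ofReal, Complex.Gamma_ofReal] at hval
  exact_mod_cast hval

theorem one_div_sub_one_pos {v : ℝ} (hv : v ∈ Ioo (0 : ℝ) 1) : 0 < 1 / v - 1 := by
  have : 1 < 1 / v := by rw [lt_div_iff₀ hv.1]; linarith [hv.2]
  linarith

theorem sqrt_pow_two_mul_add_one {x : ℝ} (hx : 0 ≤ x) (l : ℕ) :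
    Real.sqrt x ^ (2 * l + 1) = x ^ ((l : ℝ) + 1 / 2) := by
  rw [Real.sqrt_eq_rpow, ← Real.rpow_mul_natCast hx]
  congr 1; push_cast; ring

/-- The Mellin-type integral of a power of `√(1 / v - 1)`. -/
theorem integral_pow_mul_sqrt_pow {l m : ℕ} (h : l < m) :
    IntegrableOn (fun v : ℝ => v ^ (m - 1) * Real.sqrt (1 / v - 1) ^ (2 * l + 1)) (Ioo 0 1) ∧
      ∫ v in Ioo (0 : ℝ) 1, v ^ (m - 1) * Real.sqrt (1 / v - 1) ^ (2 * l + 1) =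
        Real.Gamma (m - l - 1 / 2) * Real.Gamma (l + 3 / 2) / m.factorial := by
  have h1 : (l : ℝ) + 1 ≤ m := by exact_mod_cast h
  obtain ⟨hi, hv⟩ := betaIntegral_Ioo (a := (m : ℝ) - l - 1 / 2) (b := (l : ℝ) + 3 / 2)
    (by linarith) (by positivity)
  have heq : EqOn (fun v : ℝ => v ^ ((m : ℝ) - l - 1 / 2 - 1) * (1 - v) ^ ((l : ℝ) + 3 / 2 - 1))
      (fun v : ℝ => v ^ (m - 1) * Real.sqrt (1 / v - 1) ^ (2 * l + 1)) (Ioo 0 1) := by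
    intro v hv
    have h2 : (1 : ℝ) / v - 1 = (1 - v) / v := by have := hv.1.ne'; field_simp
    have h3 : (0 : ℝ) ≤ 1 - v := by linarith [hv.2]
    simp only
    rw [sqrt_pow_two_mul_add_one (one_div_sub_one_pos hv).le, h2, Real.div_rpow h3 hv.1.le,
      ← Real.rpow_natCast v (m - 1), Nat.cast_sub (by omega)]
    have h4 : (m : ℝ) - l - 1 / 2 - 1 = ((m : ℝ) - (1 : ℕ)) - (l + 1 / 2) := by push_cast; ring
    rw [h4, Real.rpow_sub hv.1, show (l : ℝ) + 3 / 2 - 1 = l + 1 / 2 by ring]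
    ring
  rw [integrableOn_congr_fun heq measurableSet_Ioo] at hi
  rw [setIntegral_congr_fun measurableSet_Ioo heq] at hv
  refine ⟨hi, hv.trans ?_⟩
  rw [show (m : ℝ) - l - 1 / 2 + (l + 3 / 2) = m + 1 by ring, Real.Gamma_nat_eq_factorial]

theorem integral_pow_mul_pow {p m : ℕ} (h : p < m) :
    IntegrableOn (fun v : ℝ => v ^ (m - 1) * (1 / v - 1) ^ p) (Ioo 0 1) ∧
      ∫ v in Ioo (0 : ℝ) 1, v ^ (m - 1) * (1 / v - 1) ^ p =
        ((m - 1 - p).factorial : ℝ) * p.factorial / m.factorial := by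
  obtain ⟨d, rfl⟩ := Nat.exists_eq_add_of_lt h
  obtain ⟨hi, hv⟩ := betaIntegral_Ioo (a := (d : ℝ) + 1) (b := (p : ℝ) + 1)
    (by positivity) (by positivity)
  have heq : EqOn (fun v : ℝ => v ^ ((d : ℝ) + 1 - 1) * (1 - v) ^ ((p : ℝ) + 1 - 1))
      (fun v : ℝ => v ^ (p + d + 1 - 1) * (1 / v - 1) ^ p) (Ioo 0 1) := by
    intro v hv
    have h0 := hv.1.ne'
    have h2 : (1 : ℝ) / v - 1 = (1 - v) / v := by field_simp
    simp only [add_sub_cancel_right, Real.rpow_natCast, Nat.add_sub_cancel]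
    rw [h2, div_pow, pow_add]
    field_simp
  rw [integrableOn_congr_fun heq measurableSet_Ioo] at hi
  rw [setIntegral_congr_fun measurableSet_Ioo heq] at hv
  refine ⟨hi, hv.trans ?_⟩
  rw [show (d : ℝ) + 1 + (p + 1) = ((p + d + 1 : ℕ) : ℝ) + 1 by push_cast; ring,
    Real.Gamma_nat_eq_factorial, Real.Gamma_nat_eq_factorial, Real.Gamma_nat_eq_factorial,
    show p + d + 1 - 1 - p = d by omega]

/-- The Beta value is `p!/(m(m-1)⋯(m-p))`, of exact order `m^(-(p+1))`. These integrals serve as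
majorants for error terms. -/
theorem isBigO_integral_pow_mul_pow {p K : ℕ} (hK : K ≤ p + 1) :
    (fun m : ℕ => ∫ v in Ioo (0 : ℝ) 1, v ^ (m - 1) * (1 / v - 1) ^ p)
      =O[atTop] fun m : ℕ => ((m : ℝ) ^ K)⁻¹ := by
  refine IsBigO.of_bound (p.factorial * 2 ^ (p + 1)) ?_
  filter_upwards [eventually_ge_atTop (2 * p + 1)] with m hm
  rw [(integral_pow_mul_pow (show p < m by omega)).2]
  have h1 : ((m - 1 - p).factorial : ℝ) * m.descFactorial (p + 1) = m.factorial := by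
    have := Nat.factorial_mul_descFactorial (show p + 1 ≤ m by omega)
    rw [show m - (p + 1) = m - 1 - p by omega] at this
    exact_mod_cast this
  have h2 : (m : ℝ) ^ (p + 1) ≤ 2 ^ (p + 1) * (m.descFactorial (p + 1) : ℝ) := by
    have h3 := Nat.pow_sub_le_descFactorial m (p + 1)
    have h4 : m ≤ 2 * (m + 1 - (p + 1)) := by omega
    have h5 : m ^ (p + 1) ≤ 2 ^ (p + 1) * m.descFactorial (p + 1) :=
      (Nat.pow_le_pow_left h4 _).trans (by rw [mul_pow]; exact Nat.mul_le_mul_left _ h3)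
    exact_mod_cast h5
  have hm1 : (1 : ℝ) ≤ m := by exact_mod_cast (show 1 ≤ m by omega)
  have h6 : (m : ℝ) ^ K ≤ m ^ (p + 1) := pow_le_pow_right₀ hm1 hK
  have hd : (0 : ℝ) < m.descFactorial (p + 1) := by
    exact_mod_cast Nat.descFactorial_pos.2 (show p + 1 ≤ m by omega)
  have hf : (0 : ℝ) < (m - 1 - p).factorial := by exact_mod_cast Nat.factorial_pos _
  rw [Real.norm_of_nonneg (by positivity), Real.norm_of_nonneg (by positivity), ← h1,
    ← div_eq_mul_inv, div_le_div_iff₀ (by positivity) (by positivity)]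
  calc ((m - 1 - p).factorial : ℝ) * p.factorial * m ^ K
      ≤ (m - 1 - p).factorial * p.factorial * (2 ^ (p + 1) * m.descFactorial (p + 1)) := by
        gcongr; exact h6.trans h2
    _ = _ := by ring

/-- The integral of a power of `√(1 / v ^ 2 - 1)`, by the substitution `t = v ^ 2`. -/
theorem integral_pow_mul_sqrt_sq_pow {k n : ℕ} (h : k < n) :
    IntegrableOn (fun v : ℝ => v ^ (2 * n) *
      (Real.sqrt (1 / v - 1) * Real.sqrt (2 + (1 / v - 1))) ^ (2 * k + 1)) (Ioo 0 1) ∧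
    ∫ v in Ioo (0 : ℝ) 1, v ^ (2 * n) *
      (Real.sqrt (1 / v - 1) * Real.sqrt (2 + (1 / v - 1))) ^ (2 * k + 1) =
        Real.Gamma (n - k) * Real.Gamma (k + 3 / 2) / (2 * Real.Gamma (n + 3 / 2)) := by
  obtain ⟨d, rfl⟩ := Nat.exists_eq_add_of_lt h
  obtain ⟨g, hg⟩ : ∃ g : ℝ → ℝ, g = fun t => t ^ d * Real.sqrt (1 - t) ^ (2 * k + 1) := ⟨_, rfl⟩
  have hgc : Continuous g := by rw [hg]; fun_prop
  have heq : EqOn (fun v : ℝ => 1 / 2 * (g (v ^ 2) * (2 * v)))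
      (fun v : ℝ => v ^ (2 * (k + d + 1)) *
        (Real.sqrt (1 / v - 1) * Real.sqrt (2 + (1 / v - 1))) ^ (2 * k + 1)) (Ioo 0 1) := by
    intro v hv
    have h0 := hv.1.ne'
    have h1 : Real.sqrt (1 / v - 1) * Real.sqrt (2 + (1 / v - 1)) = Real.sqrt (1 - v ^ 2) / v := by
      rw [← Real.sqrt_mul (one_div_sub_one_pos hv).le]
      have h2 : (1 / v - 1) * (2 + (1 / v - 1)) = (1 - v ^ 2) / v ^ 2 := by field_simp; ring
      rw [h2, Real.sqrt_div' _ (by positivity), Real.sqrt_sq hv.1.le]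
    simp only [h1, hg, div_pow]
    -- The factor `v^(2k+1)` clears the denominator of the root; `v^(2d+1) = (v²)^d v` supplies the
    -- differential of `t = v²`.
    rw [show 2 * (k + d + 1) = (2 * k + 1) + (2 * d + 1) by ring, pow_add]
    field_simp
    ring
  have hsub := intervalIntegral.integral_comp_mul_deriv (a := (0 : ℝ)) (b := 1)
    (f := fun v : ℝ => v ^ 2) (f' := fun v => 2 * v) (g := g)
    (fun v _ => by simpa using hasDerivAt_pow 2 v) (by fun_prop) hgc
  have hint : IntegrableOn (fun v : ℝ => 1 / 2 * (g (v ^ 2) * (2 * v))) (Ioo 0 1) := by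
    have hc : Continuous fun v : ℝ => 1 / 2 * (g (v ^ 2) * (2 * v)) := by fun_prop
    exact (hc.integrableOn_Icc (a := 0) (b := 1)).mono_set Ioo_subset_Icc_self
  refine ⟨(integrableOn_congr_fun heq measurableSet_Ioo).1 hint, ?_⟩
  rw [← setIntegral_congr_fun measurableSet_Ioo heq, integral_const_mul,
    ← integral_Ioc_eq_integral_Ioo, ← intervalIntegral.integral_of_le zero_le_one]
  simp only [Function.comp_def] at hsub
  rw [hsub]
  obtain ⟨-, hv⟩ := betaIntegral_Ioo (a := (d : ℝ) + 1) (b := (k : ℝ) + 3 / 2)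
    (by positivity) (by positivity)
  have heq2 : EqOn (fun v : ℝ => v ^ ((d : ℝ) + 1 - 1) * (1 - v) ^ ((k : ℝ) + 3 / 2 - 1)) g
      (Ioo 0 1) := by
    intro v hv
    have h3 : (0 : ℝ) ≤ 1 - v := by linarith [hv.2]
    simp only [hg, add_sub_cancel_right, Real.rpow_natCast]
    rw [sqrt_pow_two_mul_add_one h3, show (k : ℝ) + 3 / 2 - 1 = k + 1 / 2 by ring]
  rw [setIntegral_congr_fun measurableSet_Ioo heq2] at hv
  rw [zero_pow two_ne_zero, one_pow, intervalIntegral.integral_of_le zero_le_one,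
    integral_Ioc_eq_integral_Ioo, hv,
    show (d : ℝ) + 1 + (k + 3 / 2) = ((k + d + 1 : ℕ) : ℝ) + 3 / 2 by push_cast; ring,
    show ((k + d + 1 : ℕ) : ℝ) - k = (d : ℝ) + 1 by push_cast; ring]
  field_simp

end BetaIntegrals

/-! ### Comparison of the expansions in `√(1 - y/ρ)` and `√(y² - ρ²)`. -/

section Connection

open MeasureTheory Set

/-- Antisymmetrising cancels the even Taylor terms, in particular degree `2K`, so the first omitted
term has degree `2K + 1`. -/
theorem isBigO_odd_part {H : ℂ → ℂ} (hH : AnalyticAt ℂ H 0) (K : ℕ) :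
    (fun z => H z - H (-z) - 2 * ∑ l ∈ Finset.range K,
      PowerSeries.coeff (2 * l + 1) (taylorSeries H 0) * z ^ (2 * l + 1))
      =O[𝓝 0] fun z => z ^ (2 * K + 1) := by
  have h1 := taylorSeries_isBigO hH (2 * K + 1)
  have hneg : Tendsto (fun z : ℂ => -z) (𝓝 0) (𝓝 0) := by
    simpa using (continuous_neg (G := ℂ)).tendsto 0
  have h2 := h1.comp_tendsto hneg
  have h3 : ((fun z : ℂ => z ^ (2 * K + 1)) ∘ fun z => -z) =O[𝓝 0] fun z : ℂ => z ^ (2 * K + 1) := by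
    refine IsBigO.of_bound 1 (Eventually.of_forall fun z => ?_)
    simp [norm_pow]
  refine (h1.sub (h2.trans h3)).congr_left fun z => ?_
  simp only [Function.comp_def]
  rw [Finset.sum_range_succ, Finset.sum_range_succ, sum_range_two_mul, sum_range_two_mul]
  have he : ∀ l : ℕ, (-z) ^ (2 * l) = z ^ (2 * l) := fun l => by rw [pow_mul, neg_sq, ← pow_mul]
  have ho : ∀ l : ℕ, (-z) ^ (2 * l + 1) = -z ^ (2 * l + 1) := fun l => by
    rw [pow_succ, he, pow_succ]; ring
  simp only [he, ho, mul_neg, Finset.sum_neg_distrib]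
  ring

/-- Glues a local and a global bound into a single majorant made of pure powers, whose integrals are
known. Away from zero, `1 + s` is at most a constant times `s`. -/
theorem exists_norm_le_pow_add_pow {D : ℝ → ℂ} {a b : ℕ} {C : ℝ}
    (h0 : D =O[𝓝 0] fun s => s ^ a) (h1 : ∀ s, 0 ≤ s → ‖D s‖ ≤ C * (1 + s) ^ b) :
    ∃ C' : ℝ, ∀ s, 0 ≤ s → ‖D s‖ ≤ C' * (s ^ a + s ^ b) := by
  obtain ⟨A, hA0, hA⟩ := h0.exists_pos
  obtain ⟨ε, hε, hball⟩ := Metric.eventually_nhds_iff_ball.1 hA.bound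
  have hC : 0 ≤ C := by
    have := (norm_nonneg _).trans (h1 0 le_rfl)
    simpa using this
  refine ⟨A + C * (1 / ε + 1) ^ b, fun s hs => ?_⟩
  rcases lt_or_ge s ε with h2 | h2
  · have h3 := hball s (by simpa [abs_of_nonneg hs] using h2)
    rw [norm_pow, Real.norm_of_nonneg hs] at h3
    have h4 : 0 ≤ s ^ b := by positivity
    have h5 : 0 ≤ C * (1 / ε + 1) ^ b * (s ^ a + s ^ b) := by positivity
    nlinarith
  · have h3 := h1 s hs
    have h4 : 1 + s ≤ (1 / ε + 1) * s := by
      have : 1 ≤ 1 / ε * s := by rw [div_mul_eq_mul_div, one_mul, le_div_iff₀ hε]; linarith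
      linarith
    have h5 : (1 + s) ^ b ≤ (1 / ε + 1) ^ b * s ^ b := by
      rw [← mul_pow]; exact pow_le_pow_left₀ (by positivity) h4 b
    have h6 : C * (1 + s) ^ b ≤ C * ((1 / ε + 1) ^ b * s ^ b) := by gcongr
    have h7 : 0 ≤ A * (s ^ a + s ^ b) := by positivity
    have h8 : 0 ≤ C * (1 / ε + 1) ^ b * s ^ a := by positivity
    nlinarith

/-- The odd Taylor coefficients in `√(1 - y / ρ)` and in `√(y ^ 2 - ρ ^ 2)` of the same function
give the same asymptotic expansion. -/
theorem isBigO_halfBinomial_sub_gamma {X Ψ : ℂ → ℂ} {ρ : ℂ} (hX : AnalyticAt ℂ X 0)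
    (hΨ : AnalyticAt ℂ Ψ 0)
    (hΨX : ∀ᶠ w in 𝓝 0, Ψ w = X (Complex.I * ρ * (w * (2 - w ^ 2) ^ (1 / 2 : ℂ)))) (K : ℕ) :
    (fun n : ℕ => (∑ l ∈ Finset.range K, PowerSeries.coeff (2 * l + 1) (taylorSeries Ψ 0) *
        (halfBinomial l (2 * n + 1) : ℂ)) -
      -(Complex.I / (2 * (Real.pi : ℂ))) * ∑ k ∈ Finset.range K,
        PowerSeries.coeff (2 * k + 1) (taylorSeries X 0) * ρ ^ (2 * k + 1) *
          ((Real.Gamma (n - k) * Real.Gamma (k + 3 / 2) / Real.Gamma (n + 3 / 2) : ℝ) : ℂ))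
      =O[atTop] fun n : ℕ => (((2 * n + 1 : ℕ) : ℝ) ^ K)⁻¹ := by
  obtain ⟨ψ, hψ⟩ : ∃ ψ : ℕ → ℂ, ψ = fun l => PowerSeries.coeff (2 * l + 1) (taylorSeries Ψ 0) :=
    ⟨_, rfl⟩
  obtain ⟨ξ, hξ⟩ : ∃ ξ : ℕ → ℂ, ξ = fun l => PowerSeries.coeff (2 * l + 1) (taylorSeries X 0) :=
    ⟨_, rfl⟩
  -- The difference of the two truncated odd parts on the cut `y = ρ(1 + s²)`, where `w = is` and
  -- `iρ w√(2 - w²) = -ρ s√(2 + s²)`.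
  obtain ⟨D, hD⟩ : ∃ D : ℝ → ℂ, D = fun s =>
    (∑ k ∈ Finset.range K, ξ k * (-ρ * ((s * Real.sqrt (2 + s ^ 2) : ℝ) : ℂ)) ^ (2 * k + 1)) -
      ∑ l ∈ Finset.range K, ψ l * (Complex.I * (s : ℂ)) ^ (2 * l + 1) := ⟨_, rfl⟩
  -- the local estimate
  have hlocal : D =O[𝓝 0] fun s => s ^ (2 * K) := by
    obtain ⟨ζ, hζ⟩ : ∃ ζ : ℂ → ℂ, ζ = fun w => Complex.I * ρ * (w * (2 - w ^ 2) ^ (1 / 2 : ℂ)) :=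
      ⟨_, rfl⟩
    have hζO : ζ =O[𝓝 0] fun w => w := by
      have hc : ContinuousAt (fun w : ℂ => Complex.I * ρ * (2 - w ^ 2) ^ (1 / 2 : ℂ)) 0 := by
        refine continuousAt_const.mul (ContinuousAt.cpow (by fun_prop) continuousAt_const ?_)
        simp
      have := (hc.isBigO_one ℂ).mul (isBigO_refl (fun w : ℂ => w) (𝓝 0))
      refine (this.congr_left fun w => ?_).congr_right fun w => one_mul w
      rw [hζ]; ring
    have hζ0 : Tendsto ζ (𝓝 0) (𝓝 0) := hζO.trans_tendsto tendsto_id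
    have hζodd : ∀ w, ζ (-w) = -ζ w := by
      intro w; rw [hζ]; simp only [neg_sq]; ring
    have hneg : Tendsto (fun z : ℂ => -z) (𝓝 0) (𝓝 0) := by
      simpa using (continuous_neg (G := ℂ)).tendsto 0
    have h1 := isBigO_odd_part hΨ K
    have h2 := ((isBigO_odd_part hX K).comp_tendsto hζ0).trans (hζO.pow (2 * K + 1))
    -- Since `ζ` is odd, the odd part of `Ψ = X ∘ ζ` is the odd part of `X` evaluated at `ζ`, so the
    -- two truncations agree to order `2K + 1`.
    have h3 : (fun w : ℂ => (∑ k ∈ Finset.range K, ξ k * ζ w ^ (2 * k + 1)) -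
        ∑ l ∈ Finset.range K, ψ l * w ^ (2 * l + 1)) =O[𝓝 0] fun w => w ^ (2 * K + 1) := by
      refine ((h1.sub h2).const_mul_left (1 / 2)).congr' ?_ EventuallyEq.rfl
      filter_upwards [hΨX, hneg.eventually hΨX] with w hw hw'
      have e1 : Ψ w = X (ζ w) := by rw [hw, hζ]
      have e2 : Ψ (-w) = X (-ζ w) := by rw [hw', ← hζodd, hζ]
      simp only [Function.comp_def, e1, e2, hξ, hψ]
      ring
    have hIs : Tendsto (fun s : ℝ => Complex.I * (s : ℂ)) (𝓝 0) (𝓝 0) := by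
      have hc : Continuous fun s : ℝ => Complex.I * (s : ℂ) := by fun_prop
      simpa using hc.tendsto 0
    have h4 := h3.comp_tendsto hIs
    have h5 : D = (fun w : ℂ => (∑ k ∈ Finset.range K, ξ k * ζ w ^ (2 * k + 1)) -
        ∑ l ∈ Finset.range K, ψ l * w ^ (2 * l + 1)) ∘ fun s : ℝ => Complex.I * (s : ℂ) := by
      funext s
      have h6 : ζ (Complex.I * (s : ℂ)) = -ρ * ((s * Real.sqrt (2 + s ^ 2) : ℝ) : ℂ) := by
        have h7 : (2 - (Complex.I * (s : ℂ)) ^ 2) ^ (1 / 2 : ℂ) =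
            ((Real.sqrt (2 + s ^ 2) : ℝ) : ℂ) := by
          rw [Real.sqrt_eq_rpow, Complex.ofReal_cpow (by positivity), mul_pow, Complex.I_sq]
          push_cast
          congr 1; ring
        rw [hζ]
        simp only [h7]
        push_cast
        linear_combination (ρ * s * (Real.sqrt (2 + s ^ 2) : ℂ)) * Complex.I_sq
      simp only [Function.comp_def, h6, hD]
    rw [h5]
    refine h4.trans (IsBigO.trans (g := fun s : ℝ => s ^ (2 * K + 1)) ?_ ?_)
    · refine IsBigO.of_bound 1 (Eventually.of_forall fun s => ?_)
      simp [norm_pow]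
    -- One order is given up to have an even exponent: `s^(2K)` is the integer power `(1/v - 1)^K`.
    · refine (isBigO_refl (fun s : ℝ => s ^ (2 * K)) (𝓝 0)).mul
        ((continuous_id.tendsto (0 : ℝ)).isBigO_one ℝ) |>.congr_right (by simp) |>.congr_left ?_
      intro s; simp [pow_succ]
  -- the global estimate
  have hglobal : ∃ C : ℝ, ∀ s, 0 ≤ s → ‖D s‖ ≤ C * (1 + s) ^ (2 * (2 * K + 1)) := by
    refine ⟨(∑ k ∈ Finset.range K, ‖ξ k‖ * ‖ρ‖ ^ (2 * k + 1)) + ∑ l ∈ Finset.range K, ‖ψ l‖,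
      fun s hs => ?_⟩
    -- Hence every term grows at most like `(1 + s)^(2(2K+1))`; this even exponent becomes `(1/v -
    -- 1)^(2K+1)`.
    have h1 : s * Real.sqrt (2 + s ^ 2) ≤ (1 + s) ^ 2 := by
      have : Real.sqrt (2 + s ^ 2) ≤ 2 + s := by
        rw [Real.sqrt_le_left (by positivity)]; nlinarith
      nlinarith
    have h2 : ∀ j, j ≤ 2 * (2 * K + 1) → (1 + s) ^ j ≤ (1 + s) ^ (2 * (2 * K + 1)) := fun j hj =>
      pow_le_pow_right₀ (by linarith) hj
    rw [hD, add_mul, Finset.sum_mul, Finset.sum_mul]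
    refine (norm_sub_le _ _).trans (add_le_add ?_ ?_)
    · refine (norm_sum_le _ _).trans (Finset.sum_le_sum fun k hk => ?_)
      have hk' := Finset.mem_range.1 hk
      rw [norm_mul, norm_pow, norm_mul, norm_neg, Complex.norm_real,
        Real.norm_of_nonneg (by positivity), mul_pow, mul_assoc]
      gcongr
      refine (pow_le_pow_left₀ (by positivity) h1 _).trans ?_
      rw [← pow_mul]
      exact h2 _ (by omega)
    · refine (norm_sum_le _ _).trans (Finset.sum_le_sum fun l hl => ?_)
      have hl' := Finset.mem_range.1 hl
      rw [norm_mul, norm_pow, norm_mul, Complex.norm_I, one_mul, Complex.norm_real,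
        Real.norm_of_nonneg hs]
      gcongr
      exact (pow_le_pow_left₀ hs (by linarith : s ≤ 1 + s) _).trans (h2 _ (by omega))
  obtain ⟨C₁, hC₁⟩ := hglobal
  obtain ⟨C, hC⟩ := exists_norm_le_pow_add_pow hlocal hC₁
  -- the integral representation
  have hrep : ∀ n : ℕ, K < n → (∑ l ∈ Finset.range K, ψ l * (halfBinomial l (2 * n + 1) : ℂ)) -
      -(Complex.I / (2 * (Real.pi : ℂ))) * (∑ k ∈ Finset.range K, ξ k * ρ ^ (2 * k + 1) *
        ((Real.Gamma (n - k) * Real.Gamma (k + 3 / 2) / Real.Gamma (n + 3 / 2) : ℝ) : ℂ)) =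
      -(Complex.I / (Real.pi : ℂ)) *
        ∫ v in Ioo (0 : ℝ) 1, (v : ℂ) ^ (2 * n) * D (Real.sqrt (1 / v - 1)) := by
    intro n hn
    -- The factor `I^(2l+1) = I(-1)^l` on the cut accounts for the sign in `halfBinomial`.
    have hA : ∀ l ∈ Finset.range K, IntegrableOn (fun v : ℝ => (ψ l * (Complex.I * (-1) ^ l)) *
        ((v ^ (2 * n) * Real.sqrt (1 / v - 1) ^ (2 * l + 1) : ℝ) : ℂ)) (Ioo 0 1) ∧
        ∫ v in Ioo (0 : ℝ) 1, (ψ l * (Complex.I * (-1) ^ l)) *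
          ((v ^ (2 * n) * Real.sqrt (1 / v - 1) ^ (2 * l + 1) : ℝ) : ℂ) =
        Complex.I * Real.pi * -(ψ l * (halfBinomial l (2 * n + 1) : ℂ)) := by
      intro l hl
      have hl' := Finset.mem_range.1 hl
      obtain ⟨h1, h2⟩ := integral_pow_mul_sqrt_pow (l := l) (m := 2 * n + 1) (by omega)
      rw [Nat.add_sub_cancel] at h1 h2
      refine ⟨(Integrable.ofReal (𝕜 := ℂ) h1).const_mul _, ?_⟩
      rw [integral_const_mul, integral_complex_ofReal, h2, halfBinomial]
      have hpi : (Real.pi : ℂ) ≠ 0 := by exact_mod_cast Real.pi_ne_zero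
      push_cast
      field_simp
      ring
    have hB : ∀ k ∈ Finset.range K, IntegrableOn (fun v : ℝ => (-(ξ k * ρ ^ (2 * k + 1))) *
        ((v ^ (2 * n) * (Real.sqrt (1 / v - 1) * Real.sqrt (2 + (1 / v - 1))) ^ (2 * k + 1) : ℝ) :
          ℂ)) (Ioo 0 1) ∧
        ∫ v in Ioo (0 : ℝ) 1, (-(ξ k * ρ ^ (2 * k + 1))) *
          ((v ^ (2 * n) * (Real.sqrt (1 / v - 1) * Real.sqrt (2 + (1 / v - 1))) ^ (2 * k + 1) : ℝ) :
            ℂ) =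
        -(1 / 2) * (ξ k * ρ ^ (2 * k + 1) *
          ((Real.Gamma (n - k) * Real.Gamma (k + 3 / 2) / Real.Gamma (n + 3 / 2) : ℝ) : ℂ)) := by
      intro k hk
      have hk' := Finset.mem_range.1 hk
      obtain ⟨h1, h2⟩ := integral_pow_mul_sqrt_sq_pow (k := k) (n := n) (by omega)
      refine ⟨(Integrable.ofReal (𝕜 := ℂ) h1).const_mul _, ?_⟩
      rw [integral_const_mul, integral_complex_ofReal, h2]
      push_cast
      field_simp
    have heq : EqOn (fun v : ℝ => (v : ℂ) ^ (2 * n) * D (Real.sqrt (1 / v - 1))) (fun v : ℝ =>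
        (∑ k ∈ Finset.range K, (-(ξ k * ρ ^ (2 * k + 1))) *
        ((v ^ (2 * n) * (Real.sqrt (1 / v - 1) * Real.sqrt (2 + (1 / v - 1))) ^ (2 * k + 1) : ℝ) :
          ℂ)) - ∑ l ∈ Finset.range K, (ψ l * (Complex.I * (-1) ^ l)) *
        ((v ^ (2 * n) * Real.sqrt (1 / v - 1) ^ (2 * l + 1) : ℝ) : ℂ)) (Ioo 0 1) := by
      intro v hv
      simp only [hD, Real.sq_sqrt (one_div_sub_one_pos hv).le]
      rw [mul_sub, Finset.mul_sum, Finset.mul_sum]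
      congr 1
      · refine Finset.sum_congr rfl fun k _ => ?_
        rw [mul_pow, Odd.neg_pow ⟨k, rfl⟩ ρ]
        push_cast
        ring
      · refine Finset.sum_congr rfl fun l _ => ?_
        have hI : Complex.I ^ (2 * l + 1) = Complex.I * (-1) ^ l := by
          rw [pow_succ, pow_mul, Complex.I_sq]; ring
        rw [mul_pow, hI]
        push_cast
        ring
    rw [setIntegral_congr_fun measurableSet_Ioo heq,
      integral_sub (integrable_finsetSum _ fun k hk => (hB k hk).1)
        (integrable_finsetSum _ fun l hl => (hA l hl).1),
      integral_finsetSum _ (fun k hk => (hB k hk).1),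
      integral_finsetSum _ (fun l hl => (hA l hl).1),
      Finset.sum_congr rfl (fun k hk => (hB k hk).2), Finset.sum_congr rfl (fun l hl => (hA l hl).2),
      ← Finset.mul_sum, ← Finset.mul_sum, Finset.sum_neg_distrib]
    have hpi : (Real.pi : ℂ) ≠ 0 := by exact_mod_cast Real.pi_ne_zero
    generalize (∑ l ∈ Finset.range K, ψ l * (halfBinomial l (2 * n + 1) : ℂ)) = Q
    generalize (∑ k ∈ Finset.range K, ξ k * ρ ^ (2 * k + 1) *
        ((Real.Gamma (n - k) * Real.Gamma (k + 3 / 2) / Real.Gamma (n + 3 / 2) : ℝ) : ℂ)) = Q'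
    field_simp
    linear_combination (2 * Real.pi * Q) * Complex.I_sq
  have hbound : (fun n : ℕ => ∫ v in Ioo (0 : ℝ) 1, (v : ℂ) ^ (2 * n) * D (Real.sqrt (1 / v - 1)))
      =O[atTop] fun n : ℕ => (((2 * n + 1 : ℕ) : ℝ) ^ K)⁻¹ := by
    have hm : Tendsto (fun n : ℕ => 2 * n + 1) atTop atTop :=
      tendsto_atTop_mono (fun n => by simp only [id]; omega) tendsto_id
    have h1 := ((isBigO_integral_pow_mul_pow (p := K) (K := K) (by omega)).comp_tendsto hm).add
      ((isBigO_integral_pow_mul_pow (p := 2 * K + 1) (K := K) (by omega)).comp_tendsto hm)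
    refine IsBigO.trans (IsBigO.of_bound C ?_) h1
    filter_upwards [eventually_gt_atTop (2 * K + 1)] with n hn
    simp only [Function.comp_def, Nat.add_sub_cancel]
    obtain ⟨i1, -⟩ := integral_pow_mul_pow (p := K) (m := 2 * n + 1) (by omega)
    obtain ⟨i2, -⟩ := integral_pow_mul_pow (p := 2 * K + 1) (m := 2 * n + 1) (by omega)
    rw [Nat.add_sub_cancel] at i1 i2
    rw [← integral_add i1 i2]
    have hnn : 0 ≤ ∫ v in Ioo (0 : ℝ) 1, (v ^ (2 * n) * (1 / v - 1) ^ K +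
        v ^ (2 * n) * (1 / v - 1) ^ (2 * K + 1)) := by
      refine setIntegral_nonneg measurableSet_Ioo fun v hv => ?_
      have := (one_div_sub_one_pos hv).le
      have := hv.1.le
      positivity
    rw [Real.norm_of_nonneg hnn, ← integral_const_mul]
    refine norm_integral_le_of_norm_le ((i1.add i2).const_mul C) ?_
    filter_upwards [ae_restrict_mem measurableSet_Ioo] with v hv
    have hq := (one_div_sub_one_pos hv).le
    rw [norm_mul, norm_pow, Complex.norm_real, Real.norm_of_nonneg hv.1.le]
    have h2 := hC _ (Real.sqrt_nonneg (1 / v - 1))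
    rw [pow_mul, pow_mul, Real.sq_sqrt hq] at h2
    calc v ^ (2 * n) * ‖D (Real.sqrt (1 / v - 1))‖
        ≤ v ^ (2 * n) * (C * ((1 / v - 1) ^ K + (1 / v - 1) ^ (2 * K + 1))) := by
          have := hv.1.le
          gcongr
      _ = _ := by ring
  refine (hbound.const_mul_left (-(Complex.I / (Real.pi : ℂ)))).congr' ?_ EventuallyEq.rfl
  filter_upwards [eventually_gt_atTop K] with n hn
  rw [← hrep n hn, hψ, hξ]

end Connection

/-! ### The sum of the series on its disc of convergence. -/

section Convergence

theorem hasFPowerSeriesOnBall_evalAt {x : PowerSeries ℝ} (h : 0 < convergenceRadius x) :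
    HasFPowerSeriesOnBall (evalAt x)
      (FormalMultilinearSeries.ofScalars ℂ fun n => ((PowerSeries.coeff n x : ℝ) : ℂ)) 0
      (convergenceRadius x) := by
  have h1 := FormalMultilinearSeries.hasFPowerSeriesOnBall _ h
  have h2 : evalAt x = (FormalMultilinearSeries.ofScalars ℂ fun n =>
      ((PowerSeries.coeff n x : ℝ) : ℂ)).sum := by
    funext y
    simp [evalAt, FormalMultilinearSeries.sum, mul_comm]
  rw [h2]
  exact h1

theorem analyticAt_evalAt {x : PowerSeries ℝ} {r : ℝ} (hr : 0 < r)
    (hrad : convergenceRadius x = ENNReal.ofReal r) {y : ℂ} (hy : y ∈ Metric.ball (0 : ℂ) r) :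
    AnalyticAt ℂ (evalAt x) y := by
  have h := hasFPowerSeriesOnBall_evalAt (x := x) (by rw [hrad]; simpa using hr)
  refine h.analyticAt_of_mem ?_
  rw [hrad]
  simpa [Metric.eball_ofReal] using hy

theorem coeff_taylorSeries_evalAt {x : PowerSeries ℝ} {r : ℝ} (hr : 0 < r)
    (hrad : convergenceRadius x = ENNReal.ofReal r) (m : ℕ) :
    PowerSeries.coeff m (taylorSeries (evalAt x) 0) = ((PowerSeries.coeff m x : ℝ) : ℂ) := by
  have h := hasFPowerSeriesOnBall_evalAt (x := x) (by rw [hrad]; simpa using hr)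
  rw [coeff_taylorSeries_of_hasFPowerSeriesAt h.hasFPowerSeriesAt,
    FormalMultilinearSeries.coeff_ofScalars]

/-- A power series with finite radius of convergence has a dominant singularity. -/
theorem nonempty_dominantSingularities {x : PowerSeries ℝ} {r : ℝ} (hr : 0 < r)
    (hrad : convergenceRadius x = ENNReal.ofReal r) :
    (dominantSingularities (evalAt x) r).Nonempty := by
  by_contra hempty
  rw [Set.not_nonempty_iff_eq_empty] at hempty
  obtain ⟨R, C, hR, hC⟩ := exists_lt_norm_coeff_mul_pow_le hr
    (fun y hy => analyticAt_evalAt hr hrad hy) (fun ζ hζ => by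
      by_contra hcon
      have : ζ ∈ dominantSingularities (evalAt x) r := ⟨hζ, hcon⟩
      rw [hempty] at this
      exact this)
  have hR0 : 0 ≤ R := (hr.trans hR).le
  -- Without singular points on the circle, the coefficients would be bounded against some `R > r`,
  -- contradicting the radius of convergence.
  have hle : (R.toNNReal : ENNReal) ≤ convergenceRadius x := by
    refine FormalMultilinearSeries.le_radius_of_bound _ C fun n => ?_
    have h1 := hC n
    rw [← coeff_taylorSeries, coeff_taylorSeries_evalAt hr hrad] at h1
    rw [FormalMultilinearSeries.ofScalars_norm, Real.coe_toNNReal _ hR0]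
    exact h1
  rw [hrad] at hle
  have : ENNReal.ofReal R ≤ ENNReal.ofReal r := hle
  rw [ENNReal.ofReal_le_ofReal_iff hr.le] at this
  linarith

end Convergence

/-! ### From powers of `n` to Gamma factors. -/

section Comparison

theorem doubleFactorial_le (n : ℕ) :
    Nat.doubleFactorial (2 * n + 1) ≤ 2 ^ (n + 1) * (n + 1).factorial := by
  induction n with
  | zero => simp [Nat.doubleFactorial]
  | succ n ih =>
    rw [show 2 * (n + 1) + 1 = (2 * n + 1) + 2 by ring, Nat.doubleFactorial_add_two,
      Nat.factorial_succ (n + 1), pow_succ]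
    calc (2 * n + 1 + 2) * Nat.doubleFactorial (2 * n + 1)
        ≤ (2 * (n + 2)) * (2 ^ (n + 1) * (n + 1).factorial) := Nat.mul_le_mul (by omega) ih
      _ = _ := by ring

theorem gamma_natCast_sub {n k : ℕ} (h : k < n) :
    Real.Gamma ((n : ℝ) - k) = (n - k - 1).factorial := by
  rw [← Real.Gamma_nat_eq_factorial]
  congr 1
  have : ((n - k - 1 : ℕ) : ℝ) + 1 = ((n - k - 1 + 1 : ℕ) : ℝ) := by push_cast; ring
  rw [this, show n - k - 1 + 1 = n - k by omega, Nat.cast_sub h.le]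

/-- Since `(2n+1)!!` is at most `2^(n+1) (n+1)!` and `Γ(n-R) = (n-R-1)!`, exactly `R + 2` factors
separate the two factorials. This fixes the exponent `R + 2`. -/
theorem isBigO_doubleFactorial_mul {r : ℝ} (hr : 0 < r) (R : ℕ) :
    (fun n : ℕ => (Nat.doubleFactorial (2 * n + 1) : ℝ) * (r ^ (2 * n + 1))⁻¹ *
      (((2 * n + 1 : ℕ) : ℝ) ^ (R + 2))⁻¹)
      =O[atTop] fun n : ℕ => ((r ^ 2 / 2) ^ n)⁻¹ * Real.Gamma ((n : ℝ) - R) := by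
  refine IsBigO.of_bound (2 / r) ?_
  filter_upwards [eventually_gt_atTop R] with n hn
  rw [gamma_natCast_sub hn, Real.norm_of_nonneg (by positivity), Real.norm_of_nonneg (by positivity)]
  have h1 : (Nat.doubleFactorial (2 * n + 1) : ℝ) ≤
      2 ^ (n + 1) * ((n - R - 1).factorial * ((2 * n + 1 : ℕ) : ℝ) ^ (R + 2)) := by
    have h2 : (n + 1).factorial ≤ (n - R - 1).factorial * (2 * n + 1) ^ (R + 2) := by
      have h3 := Nat.factorial_mul_descFactorial (show R + 2 ≤ n + 1 by omega)
      rw [show n + 1 - (R + 2) = n - R - 1 by omega] at h3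
      rw [← h3]
      exact Nat.mul_le_mul_left _ ((Nat.descFactorial_le_pow _ _).trans
        (Nat.pow_le_pow_left (by omega) _))
    exact_mod_cast (doubleFactorial_le n).trans (Nat.mul_le_mul_left _ h2)
  have hm : (0 : ℝ) < ((2 * n + 1 : ℕ) : ℝ) ^ (R + 2) := by positivity
  calc (Nat.doubleFactorial (2 * n + 1) : ℝ) * (r ^ (2 * n + 1))⁻¹ *
      (((2 * n + 1 : ℕ) : ℝ) ^ (R + 2))⁻¹
      ≤ (2 ^ (n + 1) * ((n - R - 1).factorial * ((2 * n + 1 : ℕ) : ℝ) ^ (R + 2))) *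
        (r ^ (2 * n + 1))⁻¹ * (((2 * n + 1 : ℕ) : ℝ) ^ (R + 2))⁻¹ := by gcongr
    _ = 2 / r * (((r ^ 2 / 2) ^ n)⁻¹ * (n - R - 1).factorial) := by
        rw [div_pow, ← pow_mul, pow_succ, pow_succ]
        field_simp
        ring

theorem isBigO_gamma_sub {R k : ℕ} (h : R ≤ k) :
    (fun n : ℕ => Real.Gamma ((n : ℝ) - k)) =O[atTop] fun n : ℕ => Real.Gamma ((n : ℝ) - R) := by
  refine IsBigO.of_bound 1 ?_
  filter_upwards [eventually_gt_atTop k] with n hn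
  rw [gamma_natCast_sub hn, gamma_natCast_sub (h.trans_lt hn), one_mul,
    Real.norm_of_nonneg (by positivity), Real.norm_of_nonneg (by positivity)]
  exact_mod_cast Nat.factorial_le (by omega)

theorem gamma_add_three_halves (k : ℕ) :
    Real.Gamma ((k : ℝ) + 3 / 2) =
      (Nat.doubleFactorial (2 * k + 1) : ℝ) * Real.sqrt Real.pi / 2 ^ (k + 1) := by
  have h := Real.Gamma_nat_add_half (k + 1)
  rw [show 2 * (k + 1) - 1 = 2 * k + 1 by omega] at h
  rw [← h]
  congr 1; push_cast; ring

/-- Rewriting one term of the expansion. -/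
theorem doubleFactorial_mul_gamma_term {ρ : ℂ} (hρ : ρ ≠ 0) (ξ : ℂ) (n k : ℕ) :
    (Nat.doubleFactorial (2 * n + 1) : ℂ) * (-(Complex.I / (2 * (Real.pi : ℂ))) *
      (ξ * ρ ^ (2 * k + 1) *
        ((Real.Gamma (n - k) * Real.Gamma (k + 3 / 2) / Real.Gamma (n + 3 / 2) : ℝ) : ℂ)) /
          ρ ^ (2 * n + 1)) =
      1 / (2 * (Real.pi : ℂ) * Complex.I) * ((Nat.doubleFactorial (2 * k + 1) : ℂ) * ξ) *
        (ρ ^ 2 / 2) ^ (-((n : ℤ) - (k : ℤ))) * ((Real.Gamma ((n : ℝ) - (k : ℝ)) : ℝ) : ℂ) := by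
  -- The factors `√π` cancel: `(2n+1)!! Γ(k+3/2)/Γ(n+3/2) = 2^(n-k) (2k+1)!!`. The prefactor is
  -- `-i/(2π) = 1/(2πi)`.
  rw [gamma_add_three_halves, gamma_add_three_halves]
  have h1 : (Nat.doubleFactorial (2 * n + 1) : ℂ) ≠ 0 := by
    exact_mod_cast (Nat.doubleFactorial_pos _).ne'
  have hpi : (Real.pi : ℂ) ≠ 0 := by exact_mod_cast Real.pi_ne_zero
  have hsq : ((Real.sqrt Real.pi : ℝ) : ℂ) ≠ 0 := by
    exact_mod_cast (Real.sqrt_pos.2 Real.pi_pos).ne'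
  have hρ2 : ρ ^ 2 / 2 ≠ 0 := div_ne_zero (pow_ne_zero 2 hρ) two_ne_zero
  rw [neg_sub, zpow_sub₀ hρ2, zpow_natCast, zpow_natCast, div_pow, div_pow, ← pow_mul, ← pow_mul]
  push_cast
  generalize ((Real.Gamma ((n : ℝ) - (k : ℝ)) : ℝ) : ℂ) = g
  have hI : Complex.I ≠ 0 := Complex.I_ne_zero
  rw [pow_succ, pow_succ, pow_succ, pow_succ]
  field_simp
  rw [Complex.I_sq]
  ring

end Comparison

end FormalIntegral

end

/-! ### The asymptotic expansion. -/

theorem mainTheorem1 (S x : PowerSeries ℝ)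
    (hS0 : PowerSeries.coeff 0 S = 0) (hS1 : PowerSeries.coeff 1 S = 0)
    (hS2 : PowerSeries.coeff 2 S < 0)
    (hx : FormalIntegral.IsLocalSolution S x)
    (r : ℝ) (hr : 0 < r) (hrad : FormalIntegral.convergenceRadius x = ENNReal.ofReal r)
    {ι : Type*} [Fintype ι] (τ ρ : ι → ℂ) (T : ι → ℂ → ℂ)
    (hρ : Function.Injective ρ)
    (hdom : FormalIntegral.dominantSingularities (FormalIntegral.evalAt x) r = Set.range ρ)
    (hsqrt : ∀ i, FormalIntegral.IsSquareRootAt (FormalIntegral.evalAt x) r (τ i) (ρ i))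
    (hreg : ∀ i, FormalIntegral.IsRegularPoint (T i) (τ i) (ρ i))
    (hcont : ∀ i,
      FormalIntegral.ContinuesActionAlong (FormalIntegral.evalAt x) r (ρ i) (T i)) :
    (∀ i, FormalIntegral.IsAction (FormalIntegral.shiftedAction (T i) (τ i))) ∧
    ∃ s : ι → ℂ,
      (∀ i, FormalIntegral.IsContinuedBranch (FormalIntegral.evalAt x) r (τ i) (ρ i) (T i) (s i)) ∧
      ∀ R : ℕ,
        (fun n : ℕ =>
          ((PowerSeries.coeff n (FormalIntegral.formalIntegral
              (Real.sqrt (FormalIntegral.covariance S)) S) : ℝ) : ℂ) -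
            ∑ k ∈ Finset.range R, ∑ i,
              FormalIntegral.saddleCoeff (T i) (τ i) (s i) k *
                (-T i (τ i)) ^ (-((n : ℤ) - (k : ℤ))) *
                ((Real.Gamma ((n : ℝ) - (k : ℝ)) : ℝ) : ℂ))
          =O[atTop]
        (fun n : ℕ => ∑ i, ‖-T i (τ i)‖ ^ (-(n : ℤ)) * Real.Gamma ((n : ℝ) - (R : ℝ))) := by
  open FormalIntegral in
  have hρr : ∀ i, ‖ρ i‖ = r := fun i =>
    (show ρ i ∈ dominantSingularities (evalAt x) r by rw [hdom]; exact ⟨i, rfl⟩).1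
  have hρ0 : ∀ i, ρ i ≠ 0 := fun i => by rw [← norm_pos_iff, hρr]; exact hr
  -- Needed because the comparison function, a sum over `ι`, would vanish for empty `ι`.
  have hι : Nonempty ι := by
    obtain ⟨z, hz⟩ := nonempty_dominantSingularities hr hrad
    rw [hdom] at hz
    exact ⟨hz.choose⟩
  have hloc := fun i => exists_local_uniformization hr (hρr i) (hsqrt i) (hreg i) (hcont i)
  refine ⟨fun i => (hloc i).1, ?_⟩
  choose s hs X hXa hX0 hXd hs0 hXeq hXf using fun i => (hloc i).2
  refine ⟨s, hs, fun R => ?_⟩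
  -- the formal integral at the origin
  have hformal : ∀ n : ℕ, ((PowerSeries.coeff n (formalIntegral (Real.sqrt (covariance S)) S) : ℝ) : ℂ)
      = (Nat.doubleFactorial (2 * n + 1) : ℂ) * ((PowerSeries.coeff (2 * n + 1) x : ℝ) : ℂ) := by
    intro n
    obtain ⟨hx0, hx1, hxS⟩ := hx
    obtain ⟨h1, h2⟩ := coeff_formalIntegral ⟨hS0, hS1, hS2.ne⟩ hx0 hx1.ne' hxS n
    rw [← h2, Real.sqrt_sq hx1.le, h1]
    push_cast
    rfl
  -- the formal integrals at the end points
  have hsaddle : ∀ i k, saddleCoeff (T i) (τ i) (s i) k = 1 / (2 * (Real.pi : ℂ) * Complex.I) *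
      ((Nat.doubleFactorial (2 * k + 1) : ℂ) *
        PowerSeries.coeff (2 * k + 1) (taylorSeries (X i) 0)) := by
    intro i k
    rw [saddleCoeff, ← coeff_formalIntegral_shiftedAction (hreg i).1 (hloc i).1 (hXa i) (hX0 i)
      (by rw [hXd]; exact hs0 i) (hXeq i), hXd]
  have hTτ : ∀ i, -T i (τ i) = ρ i ^ 2 / 2 := fun i => (hreg i).2.1.symm
  -- With `w² = 1 - y/ρ` one has `1 + y/ρ = 2 - w²`, so the uniformizing variable is analytic in
  -- `w`.
  obtain ⟨Ψ, hΨ⟩ : ∃ Ψ : ι → ℂ → ℂ, Ψ = fun i w =>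
    X i (Complex.I * ρ i * (w * (2 - w ^ 2) ^ (1 / 2 : ℂ))) := ⟨_, rfl⟩
  have hΨa : ∀ i, AnalyticAt ℂ (Ψ i) 0 := by
    intro i
    have hid : AnalyticAt ℂ (fun w : ℂ => w) 0 := analyticAt_id
    rw [hΨ]
    refine AnalyticAt.fun_comp (g := X i) ?_ (analyticAt_const.fun_mul (hid.fun_mul
      ((analyticAt_const.fun_sub (hid.fun_pow 2)).cpow analyticAt_const (by simp))))
    simpa using hXa i
  have hFΨ : ∀ i, evalAt x =ᶠ[𝓝[Metric.ball 0 r] (ρ i)] fun y => Ψ i (sqrtOneSub (ρ i) y) := by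
    intro i
    filter_upwards [hXf i] with y hy
    have h1 : 2 - sqrtOneSub (ρ i) y ^ 2 = 1 + y / ρ i := by rw [sqrtOneSub_sq]; ring
    rw [hy, hΨ]
    simp only [h1]
    rfl
  -- the two expansions
  have hm : Tendsto (fun n : ℕ => 2 * n + 1) atTop atTop :=
    tendsto_atTop_mono (fun n => by simp only [id]; omega) tendsto_id
  -- Two terms more than required: multiplication by `(2n+1)!!` costs two powers of `n` against
  -- `Γ(n-R)`.
  have hE1 := (isBigO_coeff_sub_halfBinomial hr (fun y hy => analyticAt_evalAt hr hrad hy) hρ hρr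
    hdom.subset hΨa hFΨ (R + 2)).comp_tendsto hm
  have hE2 := fun i => isBigO_halfBinomial_sub_gamma (ρ := ρ i) (hXa i) (hΨa i)
    (Eventually.of_forall fun w => by rw [hΨ]) (R + 2)
  simp only [Function.comp_def, coeff_taylorSeries_evalAt hr hrad] at hE1
  obtain ⟨P, hP⟩ : ∃ P : ι → ℕ → ℂ, P = fun i n => ∑ l ∈ Finset.range (R + 2),
    PowerSeries.coeff (2 * l + 1) (taylorSeries (Ψ i) 0) * (halfBinomial l (2 * n + 1) : ℂ) :=
    ⟨_, rfl⟩
  obtain ⟨Q, hQ⟩ : ∃ Q : ι → ℕ → ℂ, Q = fun (i : ι) (n : ℕ) => -(Complex.I / (2 * (Real.pi : ℂ))) *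
    ∑ k ∈ Finset.range (R + 2), PowerSeries.coeff (2 * k + 1) (taylorSeries (X i) 0) *
      ρ i ^ (2 * k + 1) * ((Real.Gamma ((n : ℝ) - (k : ℝ)) * Real.Gamma ((k : ℝ) + 3 / 2) /
        Real.Gamma ((n : ℝ) + 3 / 2) : ℝ) : ℂ) := ⟨_, rfl⟩
  have hE1' : (fun n : ℕ => (((PowerSeries.coeff (2 * n + 1) x : ℝ) : ℂ) -
      ∑ i, P i n / ρ i ^ (2 * n + 1)) * (r : ℂ) ^ (2 * n + 1))
      =O[atTop] fun n : ℕ => (((2 * n + 1 : ℕ) : ℝ) ^ (R + 2))⁻¹ := by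
    refine hE1.congr_left fun n => ?_
    simp only [hP, Finset.sum_div, mul_div_assoc]
  have hE2' : ∀ i, (fun n : ℕ => (P i n - Q i n) / ρ i ^ (2 * n + 1) * (r : ℂ) ^ (2 * n + 1))
      =O[atTop] fun n : ℕ => (((2 * n + 1 : ℕ) : ℝ) ^ (R + 2))⁻¹ := by
    intro i
    have h1 : (fun n : ℕ => P i n - Q i n)
        =O[atTop] fun n : ℕ => (((2 * n + 1 : ℕ) : ℝ) ^ (R + 2))⁻¹ := by
      rw [hP, hQ]; exact hE2 i
    refine IsBigO.trans (IsBigO.of_bound 1 (Eventually.of_forall fun n => ?_)) h1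
    have h2 : r ^ (2 * n + 1) ≠ 0 := by positivity
    rw [norm_mul, norm_div, norm_pow, norm_pow, hρr, Complex.norm_real, Real.norm_of_nonneg hr.le,
      div_mul_cancel₀ _ h2, one_mul]
  have hsum := hE1'.add (IsBigO.fun_sum fun i (_ : i ∈ Finset.univ) => hE2' i)
  have hmain : (fun n : ℕ => (Nat.doubleFactorial (2 * n + 1) : ℂ) *
      (((PowerSeries.coeff (2 * n + 1) x : ℝ) : ℂ) - ∑ i, Q i n / ρ i ^ (2 * n + 1)))
      =O[atTop] fun n : ℕ => ((r ^ 2 / 2) ^ n)⁻¹ * Real.Gamma ((n : ℝ) - R) := by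
    have h1 : (fun n : ℕ => ((Nat.doubleFactorial (2 * n + 1) : ℝ) * (r ^ (2 * n + 1))⁻¹ : ℝ))
        =O[atTop] fun n : ℕ => (Nat.doubleFactorial (2 * n + 1) : ℝ) * (r ^ (2 * n + 1))⁻¹ :=
      isBigO_refl _ _
    refine IsBigO.trans ?_ (isBigO_doubleFactorial_mul hr R)
    have h2 := (Complex.isBigO_ofReal_left.2 h1).mul hsum
    refine h2.congr_left fun n => ?_
    have h3 : (r : ℂ) ^ (2 * n + 1) ≠ 0 := by
      exact pow_ne_zero _ (by exact_mod_cast hr.ne')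
    rw [← Finset.sum_mul, ← add_mul]
    have h4 : ∑ i, (P i n - Q i n) / ρ i ^ (2 * n + 1) =
        ∑ i, P i n / ρ i ^ (2 * n + 1) - ∑ i, Q i n / ρ i ^ (2 * n + 1) := by
      rw [← Finset.sum_sub_distrib]
      exact Finset.sum_congr rfl fun i _ => sub_div _ _ _
    rw [h4]
    push_cast
    field_simp
    ring
  have hterm : ∀ i n, (Nat.doubleFactorial (2 * n + 1) : ℂ) * (Q i n / ρ i ^ (2 * n + 1)) =
      ∑ k ∈ Finset.range (R + 2), saddleCoeff (T i) (τ i) (s i) k *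
        (-T i (τ i)) ^ (-((n : ℤ) - (k : ℤ))) * ((Real.Gamma ((n : ℝ) - (k : ℝ)) : ℝ) : ℂ) := by
    intro i n
    simp only [hQ]
    rw [Finset.mul_sum, Finset.sum_div, Finset.mul_sum]
    refine Finset.sum_congr rfl fun k _ => ?_
    rw [doubleFactorial_mul_gamma_term (hρ0 i), hsaddle, hTτ]
  have hnorm : ∀ i, ‖-T i (τ i)‖ = r ^ 2 / 2 := by
    intro i
    rw [hTτ, norm_div, norm_pow, hρr]; simp
  have hrest : ∀ k, R ≤ k → ∀ i, (fun n : ℕ => saddleCoeff (T i) (τ i) (s i) k *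
        (-T i (τ i)) ^ (-((n : ℤ) - (k : ℤ))) * ((Real.Gamma ((n : ℝ) - (k : ℝ)) : ℝ) : ℂ))
      =O[atTop] fun n : ℕ => ((r ^ 2 / 2) ^ n)⁻¹ * Real.Gamma ((n : ℝ) - R) := by
    intro k hk i
    refine IsBigO.mul ?_ (Complex.isBigO_ofReal_left.2 (isBigO_gamma_sub hk))
    refine IsBigO.of_bound (‖saddleCoeff (T i) (τ i) (s i) k‖ * (r ^ 2 / 2) ^ k)
      (Eventually.of_forall fun n => le_of_eq ?_)
    have h1 : r ^ 2 / 2 ≠ 0 := by positivity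
    rw [norm_mul, norm_zpow, hnorm, neg_sub, zpow_sub₀ h1, zpow_natCast, zpow_natCast,
      Real.norm_of_nonneg (by positivity)]
    ring
  have hrhs : (fun n : ℕ => ((r ^ 2 / 2) ^ n)⁻¹ * Real.Gamma ((n : ℝ) - R)) =O[atTop]
      fun n : ℕ => ∑ i, ‖-T i (τ i)‖ ^ (-(n : ℤ)) * Real.Gamma ((n : ℝ) - (R : ℝ)) := by
    refine IsBigO.of_bound 1 (Eventually.of_forall fun n => ?_)
    simp only [hnorm, zpow_neg, zpow_natCast, Finset.sum_const, nsmul_eq_mul, Finset.card_univ]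
    rw [norm_mul (Fintype.card ι : ℝ), one_mul, Real.norm_natCast]
    have h1 : (1 : ℝ) ≤ Fintype.card ι := by exact_mod_cast Fintype.card_pos
    exact le_mul_of_one_le_left (norm_nonneg _) h1
  refine IsBigO.trans ?_ hrhs
  have htail : ∀ k, R ≤ k → (fun n : ℕ => ∑ i, saddleCoeff (T i) (τ i) (s i) k *
        (-T i (τ i)) ^ (-((n : ℤ) - (k : ℤ))) * ((Real.Gamma ((n : ℝ) - (k : ℝ)) : ℝ) : ℂ))
      =O[atTop] fun n : ℕ => ((r ^ 2 / 2) ^ n)⁻¹ * Real.Gamma ((n : ℝ) - R) := fun k hk =>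
    IsBigO.fun_sum fun i _ => hrest k hk i
  refine ((hmain.add (htail R le_rfl)).add (htail (R + 1) (by omega))).congr_left fun n => ?_
  rw [hformal, mul_sub, Finset.mul_sum, Finset.sum_congr rfl fun i _ => hterm i n,
    Finset.sum_comm, Finset.sum_range_succ, Finset.sum_range_succ]
  ring
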